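/- **Definitions.** A graph is a set of unordered pairs; $|G|$ denotes the cardinality of the set $G$, and $G\cap M$, $G\setminus M$ are the set-theoretic intersection and difference. For a formula $\varphi(v_1,\dots,v_n)$ of the first-order language of set theory, $\varphi^M$ denotes its relativization to the set $M$. For a finite set $\Sigma$ of such formulas, a set $M$ is a *$\Sigma$-elementary submodel* if $\varphi(x_1,\dots,x_n)\Leftrightarrow\varphi^M(x_1,\dots,x_n)$ for all $\varphi\in\Sigma$ and all $x_1,\dots,x_n\in M$. Cardinals are identified with initial von Neumann ordinals, so that $|M|\subseteq M$ makes sense. For an infinite cardinal $\kappa$, a sequence of sets $\langle M_\alpha:\alpha<\kappa\rangle$ is *increasing* (*$\in$-increasing*) if $M_\beta\subseteq M_\alpha$ ($M_\beta\in M_\alpha$) whenever $\beta<\alpha<\kappa$; an increasing sequence is *continuous* if $M_\alpha=\bigcup_{\beta<\alpha}M_\beta$ for every nonzero limit ordinal $\alpha<\kappa$. For a regular uncountable cardinal $\kappa$, a *club* of $\kappa$ is an unbounded subset $C\subseteq\kappa$ with $\sup B\in C$ for every nonempty $B\subseteq C$ bounded in $\kappa$, and a subset of $\kappa$ is *stationary*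 if it meets every club of $\kappa$. A class $\Phi$ of graphs is *well-reflecting* if there is a finite set $\Sigma$ of formulas such that for every $\Sigma$-elementary submodel $M$ with $|M|\subseteq M$ and every $G\in\Phi\cap M$ we have $G\cap M\in\Phi$ and $G\setminus M\in\Phi$. A class $\Phi$ of graphs is *weakly reflecting* if there is a finite set $\Sigma$ of formulas such that - for every countable $\Sigma$-elementary submodel $M$ and every $G\in\Phi\cap M$ we have $G\cap M\in\Phi$; and - if $\kappa$ is an uncountable regular cardinal and $\langle M_\alpha:\alpha<\kappa\rangle$ is an increasing, continuous and $\in$-increasing sequence of $\Sigma$-elementary submodels with $\kappa>|M_\alpha|\subseteq M_\alpha$ for every $\alpha<\kappa$, then for every $G\in\Phi\cap M_0$ there is a club $C_G$ of $\kappa$ such that $G\setminus M_\alpha\in\Phi$ for every $\alpha\in C_G$. Let $\kappa$ be an uncountable cardinal and $\kappa^+$ its successor cardinal. A set $A\subseteq\kappa^+$ is *approachable* if there is a sequence $\langle a_\alpha:\alpha<\kappa^+\rangle$ of subsets of $\kappa^+$ of size less than $\kappa$ such that for every $\alpha\in A$ there is a set $c_\alpha\subseteq\alpha$, cofinal in $\alpha$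 and of order type $\mathrm{cf}(\alpha)$, with $\gamma\cap c_\alpha\in\{a_\beta:\beta<\alpha\}$ for every $\gamma<\alpha$. The approachability ideal $I[\kappa^+]$ consists of those $A'\subseteq\kappa^+$ for which there is an approachable $A\subseteq A'$ such that $A'\setminus A$ is not stationary in $\kappa^+$. Finally, $S^{\kappa^+}_\kappa:=\{\alpha<\kappa^+:\mathrm{cf}(\alpha)=\kappa\}$. **Theorem (ZFC).** Let $\Psi\subseteq\Phi$ be classes of graphs such that: 1. every countable graph in $\Phi$ is in $\Psi$; 2. $\Psi$ is closed under taking the union of arbitrarily many pairwise disjoint members; 3. $\Phi$ is weakly reflecting and $\Psi$ is well-reflecting. Then every $G\in\Phi$ with $|G|\le\aleph_2$ is in $\Psi$. Furthermore, if for every uncountable regular cardinal $\kappa$ there is a set $S\subseteq S^{\kappa^+}_\kappa$ that is stationary in $\kappa^+$ and belongs to $I[\kappa^+]$, then $\Phi=\Psi$. -/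

import Mathlib

universe u

open Cardinal

namespace Reflection

/-! The universe of sets is `ZFSet.{u}`, and classes of sets are arbitrary `Set ZFSet.{u}`. -/

/-- The only nonlogical symbol of the language of set theory: the binary relation symbol `∈`. -/
inductive SetRel : ℕ → Type
  | mem : SetRel 2

/-- The first-order language of set theory (equality is part of the logic). -/
def setLang : FirstOrder.Language := ⟨fun _ => Empty, SetRel⟩

/-- The universe of sets as a structure for the language of set theory. -/
instance universeStructure : setLang.Structure ZFSet.{u} where
  funMap f := nomatch f
  RelMap | .mem => fun x => x 0 ∈ x 1

/-- A set `M` with the restriction of `∈`. Truth in this structure is truth of the formulas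
whose quantifiers are relativized to `M`. -/
instance setStructure (M : ZFSet.{u}) : setLang.Structure M where
  funMap f := nomatch f
  RelMap | .mem => fun x => (x 0 : ZFSet.{u}) ∈ (x 1 : ZFSet.{u})

/-- First-order formulas of set theory with finitely many free variables. -/
abbrev SetFormula : Type := Σ n : ℕ, setLang.Formula (Fin n)

/-- `M` is a `φ`-elementary submodel of the universe: `φ(x₁,…,xₙ) ↔ φ^M(x₁,…,xₙ)` for all
`x₁,…,xₙ ∈ M`. -/
def IsElementaryFor (φ : SetFormula) (M : ZFSet.{u}) : Prop :=
  ∀ x : Fin φ.1 → M, φ.2.Realize (fun i => (x i : ZFSet.{u})) ↔ φ.2.Realize x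

/-- `M` is a `T`-elementary submodel of the universe, for a finite set `T` of formulas. -/
def IsElementarySubmodel (T : Finset SetFormula) (M : ZFSet.{u}) : Prop :=
  ∀ φ ∈ T, IsElementaryFor φ M

/-- `|M| ⊆ M`, where the cardinal `|M|` is the corresponding initial von Neumann ordinal. -/
def ContainsOwnCard (M : ZFSet.{u}) : Prop :=
  M.card.ord.toZFSet ⊆ M

/-- A graph is a set of unordered pairs `{a, b}` (the case `a = b`, a loop, is allowed). -/
def IsGraph (G : ZFSet.{u}) : Prop :=
  ∀ e ∈ G, ∃ a b : ZFSet.{u}, e = {a, b}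

/-- Well-reflecting classes. -/
def WellReflecting (Φ : Set ZFSet.{u}) : Prop :=
  ∃ T : Finset SetFormula, ∀ M : ZFSet.{u}, IsElementarySubmodel T M → ContainsOwnCard M →
    ∀ G ∈ Φ, G ∈ M → G ∩ M ∈ Φ ∧ G \ M ∈ Φ

/-- A `κ`-sequence of sets is increasing. -/
def IsIncreasing {κ : Cardinal.{u}} (M : Set.Iio κ.ord → ZFSet.{u}) : Prop :=
  ∀ α β, β < α → M β ⊆ M α

/-- A `κ`-sequence of sets is `∈`-increasing. -/
def IsMemIncreasing {κ : Cardinal.{u}} (M : Set.Iio κ.ord → ZFSet.{u}) : Prop :=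
  ∀ α β, β < α → M β ∈ M α

/-- A `κ`-sequence of sets is continuous: `M α = ⋃_{β<α} M β` for all (nonzero) limit `α < κ`. -/
def IsContinuousSeq {κ : Cardinal.{u}} (M : Set.Iio κ.ord → ZFSet.{u}) : Prop :=
  ∀ α : Set.Iio κ.ord, Order.IsSuccLimit (α : Ordinal.{u}) →
    ∀ x, x ∈ M α ↔ ∃ β < α, x ∈ M β

/-- Weakly reflecting classes. -/
def WeaklyReflecting (Φ : Set ZFSet.{u}) : Prop :=
  ∃ T : Finset SetFormula,
    (∀ M : ZFSet.{u}, IsElementarySubmodel T M → M.card ≤ ℵ₀ →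
      ∀ G ∈ Φ, G ∈ M → G ∩ M ∈ Φ) ∧
    (∀ κ : Cardinal.{u}, ℵ₀ < κ → κ.IsRegular →
      ∀ M : Set.Iio κ.ord → ZFSet.{u},
        IsIncreasing M → IsContinuousSeq M → IsMemIncreasing M →
        (∀ α, IsElementarySubmodel T (M α)) →
        (∀ α, (M α).card < κ ∧ ContainsOwnCard (M α)) →
        ∀ G ∈ Φ, (∀ α : Set.Iio κ.ord, (α : Ordinal.{u}) = 0 → G ∈ M α) →
          ∃ C : Set (Set.Iio κ.ord), IsClub C ∧ ∀ α ∈ C, G \ M α ∈ Φ)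

/-- The class `Ψ` is closed under unions of arbitrary sets of pairwise disjoint members. -/
def ClosedUnderDisjointUnions (Ψ : Set ZFSet.{u}) : Prop :=
  ∀ F : ZFSet.{u}, (∀ G ∈ F, G ∈ Ψ) → (∀ G ∈ F, ∀ H ∈ F, G ≠ H → G ∩ H = ∅) → F.sUnion ∈ Ψ

/-- The set of ordinals below the successor cardinal `κ⁺`. -/
abbrev BelowSucc (κ : Cardinal.{u}) : Type (u + 1) := Set.Iio (Order.succ κ).ord

/-- `a` is an approaching sequence for `A ⊆ κ⁺`. -/
def IsApproachingSeq (κ : Cardinal.{u}) (a : BelowSucc κ → Set (BelowSucc κ))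
    (A : Set (BelowSucc κ)) : Prop :=
  (∀ β, #(a β) < Cardinal.lift.{u + 1} κ) ∧
  ∀ α ∈ A, ∃ c : Set (BelowSucc κ),
    c ⊆ Set.Iio α ∧
    (∀ ξ < α, ∃ η ∈ c, ξ ≤ η) ∧
    Ordinal.type (fun x y : c => x < y) = Ordinal.lift.{u + 1} (α : Ordinal.{u}).cof.ord ∧
    ∀ γ < α, ∃ β < α, Set.Iio γ ∩ c = a β

/-- `A ⊆ κ⁺` is approachable. -/
def IsApproachable (κ : Cardinal.{u}) (A : Set (BelowSucc κ)) : Prop :=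
  ∃ a : BelowSucc κ → Set (BelowSucc κ), IsApproachingSeq κ a A

/-- The approachability ideal `I[κ⁺]`. -/
def approachabilityIdeal (κ : Cardinal.{u}) : Set (Set (BelowSucc κ)) :=
  {A' | ∃ A ⊆ A', IsApproachable κ A ∧ ¬ IsStationary (A' \ A)}

/-- The set `S^{κ⁺}_κ` of ordinals below `κ⁺` of cofinality `κ`. -/
def cofSet (κ : Cardinal.{u}) : Set (BelowSucc κ) :=
  {α | (α : Ordinal.{u}).cof = κ}

end Reflection

/-!
Call a set `M` *good* if `H ∩ M ∈ Ψ` for all `H ∈ Φ` with `H ∈ M`. The aim is to find good models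
that contain a given `G ∈ Φ` both as an element and as a subset, since then `G = G ∩ M ∈ Ψ`. All
models considered are elementary for all formulas at once (they are closed under Skolem functions of
the universe for each single formula) and closed under countably many further operations.

The central notion is `HasGoodChains Φ Ψ κ`: every continuous chain of length `κ` of models of
cardinality less than `κ` that are closed under suitable operations is good at stationarily many
stages. Two consequences make it useful.

* The union of such a chain is good (`isGood_of_isStationary`). Weak reflection gives a club of
  stages at which the remainder `H \ N j` is in `Φ`. Cutting `H` along the good stages in that club
  leaves pieces `(H \ N k) ∩ N j` that are traces of members of `Φ` on good models, and `Ψ` is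
  closed under disjoint unions. In particular every member of `Φ` of cardinality at most `κ` is in
  `Ψ` (`mem_of_hasGoodChains`).
* For `κ = ν⁺`, every set of cardinality at most `ν` lies in a good model of cardinality `ν`
  (`exists_good_model`).

`HasGoodChains Φ Ψ κ` is proved by induction on the regular uncountable cardinal `κ`.

* For `κ = ℵ₁` all models of a chain are countable, and weak reflection applies directly.
* If `κ` is a limit cardinal, a stage of cofinality `ω` is the union of an increasing sequence of
  good models, each an element of the next (`hasGoodChains_of_limit`).
* If `κ = μ⁺` with `μ` singular, a stage of cofinality `ω` is the union of a matrix of good models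
  `K ν n` with `ν < μ` and `n < ω`. Its rows are cut off one after another, and this is the place
  where well-reflection of `Ψ` enters (`mem_of_matrix`).
* If `κ = μ⁺` with `μ` regular, a stage of cofinality `μ` that is approachable is the union of a
  chain of length `μ` whose members are elements of the stage. The chain is a canonical tower along
  an approaching sequence, which can be decoded inside the stage (`isGood_of_approaching`).

For graphs of cardinality at most `ℵ₂` only the lengths `ℵ₁` and `ℵ₂` are needed. The step from `ℵ₁`
to `ℵ₂` needs no approachability: every element of a graph of cardinality at most `κ⁺` has an index
below `κ⁺`, so a model at a stage `α` may be replaced by any model with the same ordinals below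
`κ⁺`, and there is one that is the union of a chain of length `κ` (`hasGoodChains_succ_of_card_le`).
-/

namespace Reflection

/-! ### Small sets of sets -/

theorem exists_zfset_of_card_le {S : Set ZFSet.{u}} {c : Cardinal.{u}}
    (h : #S ≤ lift.{u + 1} c) : ∃ x : ZFSet.{u}, (∀ y, y ∈ x ↔ y ∈ S) ∧ x.card ≤ c := by
  have hs : Small.{u} S := by
    rw [small_iff_lift_mk_lt_univ]
    rw [Cardinal.lift_id'.{u+1,u+1}]
    exact h.trans_lt (by simpa using lift_lt_univ c)
  refine ⟨ZFSet.range (Subtype.val : S → ZFSet), by simp, ?_⟩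
  rw [← Cardinal.lift_le.{u + 1}, ← ZFSet.cardinalMk_coe_sort]
  refine le_trans (le_of_eq ?_) h
  apply Cardinal.mk_congr
  exact Equiv.subtypeEquivRight (by simp)

theorem card_le_of_cover {ι : Type (u + 1)} {x : ZFSet.{u}} {y : ι → ZFSet.{u}} {ν : Cardinal.{u}}
    (hν : ℵ₀ ≤ ν) (hι : #ι ≤ lift.{u + 1} ν) (hy : ∀ i, (y i).card ≤ ν)
    (hx : ∀ z ∈ x, ∃ i, z ∈ y i) : x.card ≤ ν := by
  rw [← Cardinal.lift_le.{u + 1}, ← ZFSet.cardinalMk_coe_sort]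
  calc #x ≤ #(⋃ i, ((y i : ZFSet) : Set ZFSet.{u})) :=
        Cardinal.mk_le_mk_of_subset (s := (x : Set ZFSet)) (fun z hz => by simpa using hx z hz)
    _ ≤ Cardinal.sum fun i => #(y i) := Cardinal.mk_iUnion_le_sum_mk
    _ ≤ Cardinal.sum fun _ : ι => lift.{u + 1} ν := Cardinal.sum_le_sum _ _ fun i => by
        rw [ZFSet.cardinalMk_coe_sort]; simpa using hy i
    _ = #ι * lift.{u + 1} ν := by simp
    _ ≤ lift.{u + 1} ν * lift.{u + 1} ν := mul_le_mul_left hι _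
    _ = lift.{u + 1} ν := Cardinal.mul_eq_self (by simpa using hν)

theorem card_lt_of_cover {ι : Type (u + 1)} {x : ZFSet.{u}} {y : ι → ZFSet.{u}} {μ : Cardinal.{u}}
    (hμ : μ.IsRegular) (hι : #ι < lift.{u + 1} μ) (hy : ∀ i, (y i).card < μ)
    (hx : ∀ z ∈ x, ∃ i, z ∈ y i) : x.card < μ := by
  rw [← Cardinal.lift_lt.{u, u + 1}, ← ZFSet.cardinalMk_coe_sort]
  calc #x ≤ #(⋃ i, ((y i : ZFSet) : Set ZFSet.{u})) :=
        Cardinal.mk_le_mk_of_subset (s := (x : Set ZFSet)) (fun z hz => by simpa using hx z hz)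
    _ ≤ Cardinal.sum fun i => #(y i) := Cardinal.mk_iUnion_le_sum_mk
    _ < lift.{u + 1} μ := Cardinal.sum_lt_of_isRegular (isRegular_lift_iff.2 hμ) hι fun i => by
        rw [ZFSet.cardinalMk_coe_sort]; simpa using hy i

theorem card_toZFSet_ord (c : Cardinal.{u}) : c.ord.toZFSet.card = c := by
  simp

theorem card_insert_le_of_infinite {x y : ZFSet.{u}} {ν : Cardinal.{u}} (hν : ℵ₀ ≤ ν)
    (hy : y.card ≤ ν) : (insert x y : ZFSet).card ≤ ν :=
  ZFSet.card_insert_le.trans (Cardinal.add_le_of_le hν hy (Cardinal.one_le_aleph0.trans hν))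

theorem card_union_le_of_infinite {x y : ZFSet.{u}} {ν : Cardinal.{u}} (hν : ℵ₀ ≤ ν)
    (hx : x.card ≤ ν) (hy : y.card ≤ ν) : (x ∪ y).card ≤ ν :=
  ZFSet.card_union_le.trans (Cardinal.add_le_of_le hν hx hy)

/-! ### Sets closed under countably many operations -/

/-- A family of finitary operations on the universe of sets, presented as one map that sends a
finite tuple to the countable set of all values of the operations at that tuple. -/
structure Operations where
  toFun : List ZFSet.{u} → Set ZFSet.{u}
  countable : ∀ l, (toFun l).Countable

namespace Operations

/-- `M` is closed under the operations in `f`. -/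
def IsClosed (f : Operations.{u}) (M : ZFSet.{u}) : Prop :=
  ∀ l : List ZFSet.{u}, (∀ x ∈ l, x ∈ M) → ∀ z ∈ f.toFun l, z ∈ M

/-- The operations of `f` together with those of `g`. -/
def union (f g : Operations.{u}) : Operations.{u} :=
  ⟨fun l => f.toFun l ∪ g.toFun l, fun l => (f.countable l).union (g.countable l)⟩

theorem isClosed_union {f g : Operations.{u}} {M : ZFSet.{u}} :
    (f.union g).IsClosed M ↔ f.IsClosed M ∧ g.IsClosed M := by
  constructor
  · intro h
    exact ⟨fun l hl z hz => h l hl z (Or.inl hz), fun l hl z hz => h l hl z (Or.inr hz)⟩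
  · rintro ⟨h1, h2⟩ l hl z (hz | hz)
    exacts [h1 l hl z hz, h2 l hl z hz]

/-- The family with no operations. -/
def empty : Operations.{u} := ⟨fun _ => ∅, fun _ => Set.countable_empty⟩

/-- A single unary operation. -/
def unary (g : ZFSet.{u} → ZFSet.{u}) : Operations.{u} :=
  ⟨fun l => match l with
    | [x] => {g x}
    | _ => ∅, fun l => by
      split <;> simp⟩

/-- A single binary operation. -/
def binary (g : ZFSet.{u} → ZFSet.{u} → ZFSet.{u}) : Operations.{u} :=
  ⟨fun l => match l with
    | [x, y] => {g x y}
    | _ => ∅, fun l => by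
      split <;> simp⟩

/-- A single ternary operation. -/
def ternary (g : ZFSet.{u} → ZFSet.{u} → ZFSet.{u} → ZFSet.{u}) : Operations.{u} :=
  ⟨fun l => match l with
    | [x, y, z] => {g x y z}
    | _ => ∅, fun l => by
      split <;> simp⟩

theorem IsClosed.unary {g : ZFSet.{u} → ZFSet.{u}} {M : ZFSet.{u}}
    (h : (unary g).IsClosed M) {x : ZFSet.{u}} (hx : x ∈ M) : g x ∈ M :=
  h [x] (by simpa using hx) _ rfl

theorem IsClosed.binary {g : ZFSet.{u} → ZFSet.{u} → ZFSet.{u}} {M : ZFSet.{u}}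
    (h : (binary g).IsClosed M) {x y : ZFSet.{u}} (hx : x ∈ M) (hy : y ∈ M) : g x y ∈ M :=
  h [x, y] (by simp [hx, hy]) _ rfl

theorem IsClosed.ternary {g : ZFSet.{u} → ZFSet.{u} → ZFSet.{u} → ZFSet.{u}} {M : ZFSet.{u}}
    (h : (ternary g).IsClosed M) {x y z : ZFSet.{u}} (hx : x ∈ M) (hy : y ∈ M) (hz : z ∈ M) :
    g x y z ∈ M :=
  h [x, y, z] (by simp [hx, hy, hz]) _ rfl

/-- A union of closed sets is closed as soon as the closed sets are directed. -/
theorem isClosed_of_directed {f : Operations.{u}} {ι : Type*} [Nonempty ι] {y : ι → ZFSet.{u}}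
    (hdir : Directed (· ⊆ ·) y) (hcl : ∀ i, f.IsClosed (y i)) {x : ZFSet.{u}}
    (hx : ∀ z, z ∈ x ↔ ∃ i, z ∈ y i) : f.IsClosed x := by
  intro l hl z hz
  have key : ∀ l : List ZFSet.{u}, (∀ w ∈ l, w ∈ x) → ∃ i, ∀ w ∈ l, w ∈ y i := by
    intro l
    induction l with
    | nil => intro _; exact ⟨Classical.arbitrary ι, by simp⟩
    | cons a t ih =>
      intro h
      obtain ⟨i, hi⟩ := ih fun w hw => h w (List.mem_cons_of_mem _ hw)
      obtain ⟨j, hj⟩ := (hx a).1 (h a List.mem_cons_self)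
      obtain ⟨k, hik, hjk⟩ := hdir i j
      refine ⟨k, fun w hw => ?_⟩
      rcases List.mem_cons.1 hw with rfl | hw
      exacts [hjk hj, hik (hi w hw)]
  obtain ⟨i, hi⟩ := key l hl
  exact (hx z).2 ⟨i, hcl i l hi z hz⟩

/-- One step of the closure of a class under the operations. -/
def close (f : Operations.{u}) (A : Set ZFSet.{u}) : Set ZFSet.{u} :=
  A ∪ ⋃ l : List A, f.toFun (l.map Subtype.val)

theorem mk_close_le (f : Operations.{u}) {A : Set ZFSet.{u}} {c : Cardinal.{u + 1}}
    (hc : ℵ₀ ≤ c) (hA : #A ≤ c) : #(f.close A) ≤ c := by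
  refine (Cardinal.mk_union_le _ _).trans (Cardinal.add_le_of_le hc hA ?_)
  have hl : #(List A) ≤ c := (Cardinal.mk_list_le_max _).trans (max_le hc hA)
  calc #(⋃ l : List A, f.toFun (l.map Subtype.val))
      ≤ Cardinal.sum fun l : List A => #(f.toFun (l.map Subtype.val)) :=
        Cardinal.mk_iUnion_le_sum_mk
    _ ≤ Cardinal.sum fun _ : List A => ℵ₀ :=
        Cardinal.sum_le_sum _ _ fun l => (f.countable _).le_aleph0
    _ = #(List A) * ℵ₀ := by simp
    _ ≤ c * c := mul_le_mul' hl hc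
    _ = c := Cardinal.mul_eq_self hc

theorem exists_closed_superset (f : Operations.{u}) (A : ZFSet.{u}) :
    ∃ M : ZFSet.{u}, f.IsClosed M ∧ A ⊆ M ∧ M.card ≤ max ℵ₀ A.card := by
  let c : Cardinal.{u} := max ℵ₀ A.card
  let S : ℕ → Set ZFSet.{u} := fun n => f.close^[n] (A : Set ZFSet)
  have hS : ∀ n, S (n + 1) = f.close (S n) := fun n => Function.iterate_succ_apply' _ _ _
  have hc : ℵ₀ ≤ lift.{u + 1} c := by simp [c]
  have hcard : ∀ n, #(S n) ≤ lift.{u + 1} c := by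
    intro n
    induction n with
    | zero =>
      have : #((A : Set ZFSet.{u})) = lift.{u + 1} A.card := ZFSet.cardinalMk_coe_sort
      change #((A : Set ZFSet.{u})) ≤ _
      rw [this]
      simp [c]
    | succ n ih => rw [hS]; exact f.mk_close_le hc ih
  have hmono : Monotone S := monotone_nat_of_le_succ fun n => by
    rw [hS]; exact Set.subset_union_left
  have hU : #(⋃ n, S n) ≤ lift.{u + 1} c := by
    have h := Cardinal.mk_iUnion_le_sum_mk (f := fun n : ULift.{u + 1} ℕ => S n.down)
    have e : (⋃ n, S n) = ⋃ n : ULift.{u + 1} ℕ, S n.down := by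
      ext; simp
    rw [e]
    refine h.trans ((Cardinal.sum_le_sum _ (fun _ => lift.{u + 1} c) fun n => hcard _).trans ?_)
    simp only [sum_const, mk_uLift, mk_nat, lift_aleph0, lift_id]
    exact (mul_le_mul_left hc _).trans_eq (Cardinal.mul_eq_self hc)
  obtain ⟨M, hM, hMc⟩ := exists_zfset_of_card_le hU
  refine ⟨M, ?_, fun x hx => (hM x).2 (Set.mem_iUnion.2 ⟨0, hx⟩), hMc⟩
  intro l hl z hz
  have key : ∀ l : List ZFSet.{u}, (∀ w ∈ l, w ∈ M) → ∃ n, ∀ w ∈ l, w ∈ S n := by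
    intro l
    induction l with
    | nil => intro _; exact ⟨0, by simp⟩
    | cons a t ih =>
      intro h
      obtain ⟨i, hi⟩ := ih fun w hw => h w (List.mem_cons_of_mem _ hw)
      obtain ⟨j, hj⟩ := Set.mem_iUnion.1 ((hM a).1 (h a List.mem_cons_self))
      refine ⟨max i j, fun w hw => ?_⟩
      rcases List.mem_cons.1 hw with rfl | hw
      exacts [hmono (le_max_right _ _) hj, hmono (le_max_left _ _) (hi w hw)]
  obtain ⟨n, hn⟩ := key l hl
  refine (hM z).2 (Set.mem_iUnion.2 ⟨n + 1, ?_⟩)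
  rw [hS]
  refine Or.inr (Set.mem_iUnion.2 ⟨l.attach.map fun w => ⟨w.1, hn _ w.2⟩, ?_⟩)
  simpa [List.map_map, Function.comp_def] using hz

theorem exists_hull (f : Operations.{u}) (A : ZFSet.{u}) :
    ∃ M : ZFSet.{u}, f.IsClosed M ∧ A ⊆ M ∧ M.card = max ℵ₀ A.card ∧ ContainsOwnCard M := by
  let c : Cardinal.{u} := max ℵ₀ A.card
  obtain ⟨M, h1, h2, h3⟩ := f.exists_closed_superset (A ∪ c.ord.toZFSet)
  have hc : M.card = c := by
    apply le_antisymm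
    · exact h3.trans (max_le (le_max_left _ _) (card_union_le_of_infinite (le_max_left _ _)
        (le_max_right _ _) (card_toZFSet_ord c).le))
    · conv_lhs => rw [← card_toZFSet_ord c]
      exact ZFSet.card_mono fun x hx => h2 (ZFSet.mem_union.2 (Or.inr hx))
  refine ⟨M, h1, fun x hx => h2 (ZFSet.mem_union.2 (Or.inl hx)), hc, ?_⟩
  intro x hx
  rw [hc] at hx
  exact h2 (ZFSet.mem_union.2 (Or.inr hx))

/-- A set closed under `f` that contains `A`, has the least possible infinite cardinality, and
contains all ordinals below its own cardinality. -/
noncomputable def hull (f : Operations.{u}) (A : ZFSet.{u}) : ZFSet.{u} :=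
  (f.exists_hull A).choose

variable (f : Operations.{u}) (A : ZFSet.{u})

theorem isClosed_hull : f.IsClosed (f.hull A) := (f.exists_hull A).choose_spec.1

theorem subset_hull : A ⊆ f.hull A := (f.exists_hull A).choose_spec.2.1

theorem card_hull : (f.hull A).card = max ℵ₀ A.card := (f.exists_hull A).choose_spec.2.2.1

theorem containsOwnCard_hull : ContainsOwnCard (f.hull A) := (f.exists_hull A).choose_spec.2.2.2

end Operations

/-! ### Enumerations of sets by ordinals -/

theorem exists_enumeration : ∃ (e : ZFSet.{u} → Ordinal.{u} → ZFSet.{u})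
    (i : ZFSet.{u} → ZFSet.{u} → Ordinal.{u}),
    ∀ x, ∀ y ∈ x, i x y < x.card.ord ∧ e x (i x y) = y := by
  have key : ∀ x : ZFSet.{u}, ∃ (e : Ordinal.{u} → ZFSet.{u}) (i : ZFSet.{u} → Ordinal.{u}),
      ∀ y ∈ x, i y < x.card.ord ∧ e (i y) = y := by
    intro x
    have h : #x = #(Set.Iio x.card.ord) := by
      rw [ZFSet.cardinalMk_coe_sort, Cardinal.mk_Iio_ordinal, card_ord]
    obtain ⟨g⟩ := Cardinal.eq.1 h
    classical
    refine ⟨fun o => if ho : o < x.card.ord then g.symm ⟨o, ho⟩ else ∅,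
      fun y => if hy : y ∈ x then g ⟨y, hy⟩ else 0, fun y hy => ?_⟩
    have := (g ⟨y, hy⟩).2
    rw [Set.mem_Iio] at this
    simp [hy, this]
  choose e i h using key
  exact ⟨e, i, h⟩

/-- A fixed choice, for every set `x`, of an enumeration of `x` by the ordinals below its
cardinality. -/
noncomputable def enumSet : ZFSet.{u} → Ordinal.{u} → ZFSet.{u} := exists_enumeration.choose

/-- The position of `y` in the enumeration `enumSet x`. -/
noncomputable def indexIn : ZFSet.{u} → ZFSet.{u} → Ordinal.{u} :=
  exists_enumeration.choose_spec.choose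

theorem indexIn_lt {x y : ZFSet.{u}} (h : y ∈ x) : indexIn x y < x.card.ord :=
  (exists_enumeration.choose_spec.choose_spec x y h).1

theorem enumSet_indexIn {x y : ZFSet.{u}} (h : y ∈ x) : enumSet x (indexIn x y) = y :=
  (exists_enumeration.choose_spec.choose_spec x y h).2

/-- The least ordinal that is not an element of `x`. -/
noncomputable def leastMissing (x : ZFSet.{u}) : Ordinal.{u} := sInf {o | o.toZFSet ∉ x}

theorem toZFSet_leastMissing_notMem (x : ZFSet.{u}) : (leastMissing x).toZFSet ∉ x :=
  csInf_mem (s := {o : Ordinal.{u} | o.toZFSet ∉ x})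
    ⟨x.rank, fun h => by simpa using ZFSet.rank_lt_of_mem h⟩

theorem toZFSet_mem_of_lt_leastMissing {x : ZFSet.{u}} {o : Ordinal.{u}} (h : o < leastMissing x) :
    o.toZFSet ∈ x := by
  by_contra hn
  exact notMem_of_lt_csInf' h hn

/-! ### Models -/

instance (n : ℕ) : Countable (setLang.BoundedFormula Empty n) := by
  have h1 : setLang.card ≤ ℵ₀ := by
    have : Countable setLang.Symbols := by
      have h2 : ∀ n, Countable (SetRel n) := fun n => by
        have : Subsingleton (SetRel n) := ⟨fun a b => by cases a; cases b; rfl⟩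
        infer_instance
      have : Countable (Σ n, setLang.Functions n) := by
        have : ∀ n, IsEmpty (setLang.Functions n) := fun n => inferInstanceAs (IsEmpty Empty)
        infer_instance
      have : Countable (Σ n, setLang.Relations n) := by
        have : ∀ n, Countable (setLang.Relations n) := h2
        infer_instance
      exact inferInstanceAs (Countable ((Σ n, setLang.Functions n) ⊕ (Σ n, setLang.Relations n)))
    exact Cardinal.mk_le_aleph0_iff.2 this
  have h2 : Countable (Σ n, setLang.BoundedFormula Empty n) := by
    rw [← Cardinal.mk_le_aleph0_iff]
    refine FirstOrder.Language.BoundedFormula.card_le.trans ?_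
    simpa using h1
  exact (sigma_mk_injective (i := n)
    (β := fun n => setLang.BoundedFormula Empty n)).countable

/-- Skolem functions for all formulas of set theory. -/
noncomputable def skolemOperations : Operations.{u} :=
  ⟨fun l => Set.range fun φ : setLang.BoundedFormula Empty (l.length + 1) =>
    Classical.epsilon fun a : ZFSet.{u} =>
      φ.Realize default (Fin.snoc (α := fun _ => ZFSet.{u}) l.get a),
    fun _ => Set.countable_range _⟩

/-- The Tarski–Vaught criterion: sets closed under the Skolem functions are elementary submodels
for every formula. -/
theorem isElementarySubmodel_of_isClosed {M : ZFSet.{u}} (h : skolemOperations.IsClosed M)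
    (T : Finset SetFormula) : IsElementarySubmodel T M := by
  let f : setLang.Embedding M ZFSet.{u} :=
    { toFun := fun x => x
      inj' := Subtype.val_injective
      map_fun' := fun g => nomatch g
      map_rel' := fun {n} r x => by cases r; rfl }
  have key : ∀ (n : ℕ) (φ : setLang.BoundedFormula Empty (n + 1)) (x : Fin n → M) (a : ZFSet.{u}),
      φ.Realize default (Fin.snoc (f ∘ x) a : _ → ZFSet.{u}) →
        ∃ b : M, φ.Realize default (Fin.snoc (f ∘ x) (f b) : _ → ZFSet.{u}) := by
    intro n φ x a ha
    have hx : ∀ i, (f ∘ x) i ∈ M := fun i => (x i).2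
    generalize f ∘ x = v at hx ha
    have hl : ∃ l : List ZFSet.{u}, (⟨l.length, l.get⟩ : Σ n, Fin n → ZFSet.{u}) = ⟨n, v⟩ :=
      ⟨List.equivSigmaTuple.symm ⟨n, v⟩, List.equivSigmaTuple.apply_symm_apply _⟩
    obtain ⟨l, hl⟩ := hl
    cases hl
    refine ⟨⟨_, h l ?_ _ ⟨φ, rfl⟩⟩, ?_⟩
    · intro y hy
      obtain ⟨i, rfl⟩ := List.get_of_mem hy
      exact hx i
    · exact Classical.epsilon_spec (p := fun a : ZFSet.{u} =>
        φ.Realize default (Fin.snoc (α := fun _ => ZFSet.{u}) l.get a)) ⟨a, ha⟩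
  intro φ _ x
  refine f.isElementary_of_exists (fun n φ x a ha => ?_) φ.2 x
  have := key n φ x a (by convert ha)
  convert this

/-- The operations under which all models are closed. Ordinals enter as von Neumann ordinals, and
are recovered from them by `ZFSet.rank`. -/
noncomputable def baseOperations : Operations.{u} :=
  skolemOperations.union <| (Operations.binary (· \ ·)).union <|
  (Operations.binary (· ∩ ·)).union <| (Operations.binary (· ∪ ·)).union <|
  (Operations.binary insert).union <| (Operations.unary ZFSet.sUnion).union <|
  (Operations.unary fun x => (leastMissing x).toZFSet).union <|
  (Operations.unary fun x => x.card.ord.toZFSet).union <|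
  (Operations.binary fun x y => enumSet x y.rank).union <|
  (Operations.binary fun x y => (indexIn x y).toZFSet)

/-- An `f`-model: a set closed under the basic set operations, the Skolem functions, and `f`. -/
def IsModel (f : Operations.{u}) (M : ZFSet.{u}) : Prop :=
  (baseOperations.union f).IsClosed M

namespace IsModel

variable {f : Operations.{u}} {M x y : ZFSet.{u}}

theorem operations (h : IsModel f M) : f.IsClosed M := (Operations.isClosed_union.1 h).2

theorem base (h : IsModel f M) : baseOperations.IsClosed M := (Operations.isClosed_union.1 h).1

theorem elementary (h : IsModel f M) (T : Finset SetFormula) : IsElementarySubmodel T M := by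
  have := h.base
  simp only [baseOperations, Operations.isClosed_union] at this
  exact isElementarySubmodel_of_isClosed this.1 T

theorem sdiff_mem (h : IsModel f M) (hx : x ∈ M) (hy : y ∈ M) : x \ y ∈ M := by
  have := h.base
  simp only [baseOperations, Operations.isClosed_union] at this
  exact this.2.1.binary hx hy

theorem inter_mem (h : IsModel f M) (hx : x ∈ M) (hy : y ∈ M) : x ∩ y ∈ M := by
  have := h.base
  simp only [baseOperations, Operations.isClosed_union] at this
  exact this.2.2.1.binary hx hy

theorem union_mem (h : IsModel f M) (hx : x ∈ M) (hy : y ∈ M) : x ∪ y ∈ M := by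
  have := h.base
  simp only [baseOperations, Operations.isClosed_union] at this
  exact this.2.2.2.1.binary hx hy

theorem insert_mem (h : IsModel f M) (hx : x ∈ M) (hy : y ∈ M) : insert x y ∈ M := by
  have := h.base
  simp only [baseOperations, Operations.isClosed_union] at this
  exact this.2.2.2.2.1.binary hx hy

theorem sUnion_mem (h : IsModel f M) (hx : x ∈ M) : x.sUnion ∈ M := by
  have := h.base
  simp only [baseOperations, Operations.isClosed_union] at this
  exact this.2.2.2.2.2.1.unary hx

theorem leastMissing_mem (h : IsModel f M) (hx : x ∈ M) : (leastMissing x).toZFSet ∈ M := by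
  have := h.base
  simp only [baseOperations, Operations.isClosed_union] at this
  exact this.2.2.2.2.2.2.1.unary hx

theorem card_mem (h : IsModel f M) (hx : x ∈ M) : x.card.ord.toZFSet ∈ M := by
  have := h.base
  simp only [baseOperations, Operations.isClosed_union] at this
  exact this.2.2.2.2.2.2.2.1.unary hx

theorem enumSet_mem (h : IsModel f M) {o : Ordinal.{u}} (hx : x ∈ M) (ho : o.toZFSet ∈ M) :
    enumSet x o ∈ M := by
  have := h.base
  simp only [baseOperations, Operations.isClosed_union] at this
  simpa using this.2.2.2.2.2.2.2.2.1.binary hx ho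

theorem indexIn_mem (h : IsModel f M) (hx : x ∈ M) (hy : y ∈ M) : (indexIn x y).toZFSet ∈ M := by
  have := h.base
  simp only [baseOperations, Operations.isClosed_union] at this
  exact this.2.2.2.2.2.2.2.2.2.binary hx hy

theorem subset_of_mem (h : IsModel f M) (hx : x ∈ M) (hc : x.card.ord.toZFSet ⊆ M) : x ⊆ M := by
  intro y hy
  rw [← enumSet_indexIn hy]
  exact h.enumSet_mem hx (hc (Ordinal.toZFSet_mem_toZFSet_iff.2 (indexIn_lt hy)))

theorem subset_of_mem_of_card_le (h : IsModel f M) (hM : ContainsOwnCard M) (hx : x ∈ M)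
    (hc : x.card ≤ M.card) : x ⊆ M :=
  h.subset_of_mem hx fun _ hz => hM (Ordinal.toZFSet_subset_toZFSet_iff.2 (ord_le_ord.2 hc) hz)

theorem mono {g : Operations.{u}} (h : IsModel (f.union g) M) : IsModel f M := by
  unfold IsModel at *
  rw [Operations.isClosed_union] at *
  exact ⟨h.1, (Operations.isClosed_union.1 h.2).1⟩

end IsModel

/-- A model that contains `A`, of the least possible infinite cardinality. -/
noncomputable def modelHull (f : Operations.{u}) (A : ZFSet.{u}) : ZFSet.{u} :=
  (baseOperations.union f).hull A

theorem isModel_modelHull (f : Operations.{u}) (A : ZFSet.{u}) : IsModel f (modelHull f A) :=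
  Operations.isClosed_hull _ _

theorem subset_modelHull (f : Operations.{u}) (A : ZFSet.{u}) : A ⊆ modelHull f A :=
  Operations.subset_hull _ _

theorem card_modelHull (f : Operations.{u}) (A : ZFSet.{u}) :
    (modelHull f A).card = max ℵ₀ A.card :=
  Operations.card_hull _ _

theorem containsOwnCard_modelHull (f : Operations.{u}) (A : ZFSet.{u}) :
    ContainsOwnCard (modelHull f A) :=
  Operations.containsOwnCard_hull _ _

theorem isModel_of_directed {f : Operations.{u}} {ι : Type*} [Nonempty ι] {y : ι → ZFSet.{u}}
    (hdir : Directed (· ⊆ ·) y) (hcl : ∀ i, IsModel f (y i)) {x : ZFSet.{u}}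
    (hx : ∀ z, z ∈ x ↔ ∃ i, z ∈ y i) : IsModel f x :=
  Operations.isClosed_of_directed hdir hcl hx

variable {Φ Ψ : Set ZFSet.{u}} {f : Operations.{u}} {κ : Cardinal.{u}}
  {N : Ordinal.{u} → ZFSet.{u}}

/-! ### Clubs in regular cardinals -/

theorem cof_Iio_ord_ne_aleph0 (hκ : κ.IsRegular) (hκ' : ℵ₀ < κ) :
    Order.cof (Set.Iio κ.ord) ≠ ℵ₀ := by
  rw [Ordinal.cof_Iio, ← Ordinal.lift_cof, hκ.cof_ord]
  exact fun h => hκ'.ne' (Cardinal.lift_eq_aleph0.1 h)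

theorem iSup_nat_lt_ord (hκ : κ.IsRegular) (hκ' : ℵ₀ < κ) {s : ℕ → Ordinal.{u}}
    (hs : ∀ n, s n < κ.ord) : ⨆ n, s n < κ.ord :=
  Ordinal.lift_iSup_lt_of_lt_cof (by simpa [hκ.cof_ord] using hκ') hs

theorem exists_bound_ordinals (hκ : κ.IsRegular) {x : ZFSet.{u}} (hx : x.card < κ) :
    ∃ b < κ.ord, ∀ o < κ.ord, o.toZFSet ∈ x → o < b := by
  have hlim := Cardinal.isSuccLimit_ord hκ.aleph0_le
  classical
  let g : Shrink.{u} x → Ordinal.{u} := fun s =>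
    if ((equivShrink x).symm s : ZFSet.{u}).rank < κ.ord then
      Order.succ ((equivShrink x).symm s : ZFSet.{u}).rank else 0
  refine ⟨⨆ s, g s, Ordinal.iSup_lt_of_lt_cof (by rw [hκ.cof_ord]; exact hx) fun s => ?_,
    fun o ho hox => ?_⟩
  · dsimp only [g]
    split_ifs with h
    · exact hlim.succ_lt h
    · exact hκ.ord_pos
  · have h1 : g (equivShrink x ⟨_, hox⟩) = Order.succ o := by simp [g, ho]
    exact (Order.lt_succ o).trans_le (h1 ▸ Ordinal.le_iSup g _)

theorem isClub_Ici (a : Set.Iio κ.ord) : IsClub (Set.Ici a) := by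
  refine ⟨fun t ht ⟨y, hy⟩ _ x hx => le_trans (ht hy) (hx.1 hy), fun b =>
    ⟨max a b, le_max_left a b, le_max_right a b⟩⟩

theorem exists_lt_mem_of_isClub (hκ : ℵ₀ ≤ κ) {C : Set (Set.Iio κ.ord)} (hC : IsClub C)
    (a : Set.Iio κ.ord) : ∃ c ∈ C, a < c := by
  obtain ⟨c, hc, h⟩ := hC.isCofinal
    ⟨Order.succ a.1, (Cardinal.isSuccLimit_ord hκ).succ_lt a.2⟩
  exact ⟨c, hc, lt_of_lt_of_le (Order.lt_succ a.1) h⟩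

theorem isCofinal_inter_of_isStationary (hκ : κ.IsRegular) (hκ' : ℵ₀ < κ)
    {S C : Set (Set.Iio κ.ord)} (hS : IsStationary S) (hC : IsClub C) : IsCofinal (C ∩ S) := by
  intro a
  obtain ⟨b, hb, hb'⟩ := hS (hC.inter (cof_Iio_ord_ne_aleph0 hκ hκ') (isClub_Ici a))
  exact ⟨b, ⟨hb'.1, hb⟩, hb'.2⟩

theorem isClub_closurePoints (hκ : κ.IsRegular) (hκ' : ℵ₀ < κ)
    {R : Ordinal.{u} → Ordinal.{u} → Prop}
    (hR : ∀ i < κ.ord, ∃ b < κ.ord, ∀ j ≤ i, ∀ o, R j o → o < b) :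
    IsClub {α : Set.Iio κ.ord | ∀ i < α.1, ∀ o, R i o → o < α.1} := by
  refine ⟨fun t ht _ _ x hx i hi o ho => ?_, fun a => ?_⟩
  · obtain ⟨y, hy, hiy⟩ := (lt_isLUB_iff hx (b := ⟨i, hi.trans x.2⟩)).1 hi
    exact (ht hy i hiy o ho).trans_le (hx.1 hy)
  · choose! b hb hb' using hR
    let s : ℕ → Ordinal.{u} := fun n => Nat.rec a.1 (fun _ o => max (Order.succ o) (b o)) n
    have hs : ∀ n, s (n + 1) = max (Order.succ (s n)) (b (s n)) := fun _ => rfl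
    have hlt : ∀ n, s n < κ.ord := by
      intro n
      induction n with
      | zero => exact a.2
      | succ n ih =>
        rw [hs]
        exact max_lt ((Cardinal.isSuccLimit_ord hκ.aleph0_le).succ_lt ih) (hb _ ih)
    have hle : ∀ n, s n ≤ ⨆ n, s n := Ordinal.le_iSup s
    refine ⟨⟨⨆ n, s n, iSup_nat_lt_ord hκ hκ' hlt⟩, fun i hi o ho => ?_, hle 0⟩
    obtain ⟨n, hn⟩ := (Ordinal.lt_iSup_iff).1 hi
    exact ((hb' _ (hlt n) i hn.le o ho).trans_le ((le_max_right _ _).trans_eq (hs n).symm)).trans_le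
      (hle (n + 1))

theorem exists_omega_limit_mem (hκ : κ.IsRegular) (hκ' : ℵ₀ < κ) {C : Set (Set.Iio κ.ord)}
    (hC : IsClub C) (a : Set.Iio κ.ord) :
    ∃ (s : ℕ → Ordinal.{u}) (α : Set.Iio κ.ord), α ∈ C ∧ StrictMono s ∧ a.1 ≤ s 0 ∧
      (∀ n, s n < α.1) ∧ ∀ β < α.1, ∃ n, β < s n := by
  choose g hg hg' using exists_lt_mem_of_isClub hκ.aleph0_le hC
  let s : ℕ → Set.Iio κ.ord := fun n => Nat.rec (g a) (fun _ o => g o) n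
  have hs : ∀ n, s (n + 1) = g (s n) := fun _ => rfl
  have hmono : StrictMono s := strictMono_nat_of_lt_succ fun n => by rw [hs]; exact hg' _
  have hmem : ∀ n, s n ∈ C := by
    rintro (_ | n)
    · exact hg a
    · rw [hs]; exact hg _
  have hlt : ⨆ n, (s n).1 < κ.ord := iSup_nat_lt_ord hκ hκ' fun n => (s n).2
  have hle : ∀ n, (s n).1 ≤ ⨆ n, (s n).1 := Ordinal.le_iSup fun n => (s n).1
  refine ⟨fun n => (s n).1, ⟨_, hlt⟩, ?_, fun m n h => hmono h, (hg' a).le, fun n => ?_,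
    fun β hβ => (Ordinal.lt_iSup_iff).1 hβ⟩
  · refine hC.isLUB_mem (t := Set.range s) (by rintro _ ⟨n, rfl⟩; exact hmem n)
      (Set.range_nonempty _) ⟨by rintro _ ⟨n, rfl⟩; exact hle n, fun b hb => ?_⟩
    exact Ordinal.iSup_le fun n => hb ⟨n, rfl⟩
  · exact lt_of_lt_of_le (hmono (Nat.lt_succ_self n)) (hle (n + 1))

/-! ### Chains of models -/

/-- A continuous increasing chain of `f`-models of length `κ`, each of cardinality less than `κ`
and containing its own cardinality, such that the set of all earlier models up to a given stage is
an element of every later model. Only the values of `N` below `κ` matter. -/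
structure IsChain (f : Operations.{u}) (κ : Cardinal.{u}) (N : Ordinal.{u} → ZFSet.{u}) :
    Prop where
  isModel : ∀ i < κ.ord, IsModel f (N i)
  mono : ∀ i j, i ≤ j → j < κ.ord → N i ⊆ N j
  continuous : ∀ i < κ.ord, Order.IsSuccLimit i → ∀ x ∈ N i, ∃ j < i, x ∈ N j
  initial : ∀ i j, i < j → j < κ.ord → ∃ v ∈ N j, ∀ x, x ∈ v ↔ ∃ k ≤ i, x = N k
  card_lt : ∀ i < κ.ord, (N i).card < κ
  containsOwnCard : ∀ i < κ.ord, ContainsOwnCard (N i)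

/-- The models of a chain contain all ordinals below their index: the least ordinal missing from a
model belongs to all later ones. -/
theorem le_leastMissing {δ i : Ordinal.{u}} (hmono : ∀ i j, i ≤ j → j < δ → N i ⊆ N j)
    (hmem : ∀ i j, i < j → j < δ → (leastMissing (N i)).toZFSet ∈ N j) (hi : i < δ) :
    i ≤ leastMissing (N i) := by
  induction i using WellFoundedLT.induction with
  | ind i ih =>
    refine le_of_forall_lt fun j hj => (ih j hj (hj.trans hi)).trans_lt ?_
    by_contra! h
    refine toZFSet_leastMissing_notMem (N i) ?_
    rcases h.eq_or_lt with h | h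
    · rw [h]; exact hmem j i hj hi
    · exact hmono j i hj.le hi (toZFSet_mem_of_lt_leastMissing h)

namespace IsChain

theorem mem (h : IsChain f κ N) {i j : Ordinal.{u}} (hij : i < j) (hj : j < κ.ord) :
    N i ∈ N j := by
  obtain ⟨v, hv, hv'⟩ := h.initial i j hij hj
  have e : v.sUnion = N i := by
    ext x
    rw [ZFSet.mem_sUnion]
    constructor
    · rintro ⟨y, hy, hx⟩
      obtain ⟨k, hk, rfl⟩ := (hv' y).1 hy
      exact h.mono k i hk (hij.trans hj) hx
    · exact fun hx => ⟨N i, (hv' _).2 ⟨i, le_rfl, rfl⟩, hx⟩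
  exact e ▸ (h.isModel j hj).sUnion_mem hv

theorem toZFSet_mem (h : IsChain f κ N) {i o : Ordinal.{u}} (hi : i < κ.ord) (ho : o < i) :
    o.toZFSet ∈ N i :=
  toZFSet_mem_of_lt_leastMissing (ho.trans_le (le_leastMissing h.mono
    (fun _ j hij hj => (h.isModel j hj).leastMissing_mem (h.mem hij hj)) hi))

theorem sub (h : IsChain f κ N) {g : Operations.{u}} (hg : ∀ M, IsModel f M → IsModel g M) :
    IsChain g κ N :=
  { h with isModel := fun i hi => hg _ (h.isModel i hi) }

/-- The model at the least upper bound of a nonempty set of indices is the union of the models at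
these indices. -/
theorem exists_mem_of_isLUB (h : IsChain f κ N) {t : Set (Set.Iio κ.ord)} {k : Set.Iio κ.ord}
    (ht : t.Nonempty) (hk : IsLUB t k) {x : ZFSet.{u}} (hx : x ∈ N k) : ∃ j ∈ t, x ∈ N j := by
  by_cases hkt : k ∈ t
  · exact ⟨k, hkt, hx⟩
  have hlt : ∀ j ∈ t, j.1 < k.1 := fun j hj =>
    lt_of_le_of_ne (hk.1 hj) fun e => hkt (by rwa [← Subtype.ext e])
  have hlim : Order.IsSuccLimit k.1 := by
    obtain ⟨j, hj⟩ := ht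
    refine ⟨fun hmin => not_lt_of_ge (hmin.isBot j.1) (hlt j hj), fun b hb => ?_⟩
    obtain ⟨c, hc, hbc⟩ := (lt_isLUB_iff hk (b := ⟨b, hb.1.trans k.2⟩)).1 hb.1
    exact hb.2 (c := c.1) hbc (hlt c hc)
  obtain ⟨j, hj, hxj⟩ := h.continuous k k.2 hlim x hx
  obtain ⟨c, hc, hjc⟩ := (lt_isLUB_iff hk (b := ⟨j, hj.trans k.2⟩)).1 hj
  exact ⟨c, hc, h.mono j c hjc.le c.2 hxj⟩

/-- The set of limit stages `α` below which the ordinals in the models are bounded by `α`, so that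
the model at `α` has exactly the elements of `α` as its ordinals below `κ`. -/
theorem isClub_closure (hκ : κ.IsRegular) (hκ' : ℵ₀ < κ) (h : IsChain f κ N) :
    IsClub {α : Set.Iio κ.ord | ∀ i < α.1, ∀ o,
      (o < κ.ord ∧ o.toZFSet ∈ N i ∨ o = Order.succ i) → o < α.1} := by
  refine isClub_closurePoints hκ hκ' fun i hi => ?_
  obtain ⟨b, hb, hb'⟩ := exists_bound_ordinals hκ (h.card_lt i hi)
  have hlim := Cardinal.isSuccLimit_ord hκ.aleph0_le
  refine ⟨max b (Order.succ (Order.succ i)), max_lt hb (hlim.succ_lt (hlim.succ_lt hi)), ?_⟩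
  rintro j hj o (⟨ho, hoj⟩ | rfl)
  · exact lt_max_of_lt_left (hb' o ho (h.mono j i hj hi hoj))
  · exact lt_max_of_lt_right (Order.lt_succ_of_le (Order.succ_le_succ hj))

theorem subset_of_mem_of_closure (h : IsChain f κ N) {α : Set.Iio κ.ord}
    (hα : ∀ i < α.1, ∀ o, (o < κ.ord ∧ o.toZFSet ∈ N i ∨ o = Order.succ i) → o < α.1)
    (hcov : ∀ x ∈ N α, ∃ i < α.1, x ∈ N i) {x : ZFSet.{u}} (hx : x ∈ N α) (hc : x.card < κ) :
    x ⊆ N α := by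
  have hM := h.isModel α α.2
  refine hM.subset_of_mem hx fun z hz => ?_
  obtain ⟨o, ho, rfl⟩ := Ordinal.mem_toZFSet_iff.1 hz
  obtain ⟨i, hi, hxi⟩ := hcov _ (hM.card_mem hx)
  exact h.toZFSet_mem α.2 (ho.trans (hα i hi _ (Or.inl ⟨ord_lt_ord.2 hc, hxi⟩)))

/-- In every club there are stages of cofinality `ω` at which the model contains each of its small
elements as a subset. -/
theorem exists_omega_stage (hκ : κ.IsRegular) (hκ' : ℵ₀ < κ) (h : IsChain f κ N)
    {D : Set (Set.Iio κ.ord)} (hD : IsClub D) (a : Set.Iio κ.ord) :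
    ∃ (s : ℕ → Ordinal.{u}) (α : Set.Iio κ.ord), α ∈ D ∧ StrictMono s ∧ a.1 ≤ s 0 ∧
      (∀ n, s n < α.1) ∧ (∀ x ∈ N α, ∃ n, x ∈ N (s n)) ∧
      ∀ x ∈ N α, x.card < κ → x ⊆ N α := by
  obtain ⟨s, α, ⟨hαD, hαE⟩, hs, has, hsα, hαs⟩ := exists_omega_limit_mem hκ hκ'
    (hD.inter (cof_Iio_ord_ne_aleph0 hκ hκ') (h.isClub_closure hκ hκ')) a
  have hlim : Order.IsSuccLimit α.1 := by
    refine ⟨fun h => not_lt_of_ge (h.isBot (s 0)) (hsα 0), fun β hβ => ?_⟩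
    exact (hαE β hβ.1 _ (Or.inr rfl)).ne' (Order.succ_eq_of_covBy hβ).symm
  have hcov : ∀ x ∈ N α, ∃ i < α.1, x ∈ N i := h.continuous α α.2 hlim
  refine ⟨s, α, hαD, hs, has, hsα, fun x hx => ?_, fun x =>
    h.subset_of_mem_of_closure hαE hcov⟩
  obtain ⟨i, hi, hxi⟩ := hcov x hx
  obtain ⟨n, hn⟩ := hαs i hi
  exact ⟨n, h.mono _ _ hn.le ((hsα n).trans α.2) hxi⟩

end IsChain

/-! ### Good models -/

/-- A set `M` is good if every `H ∈ Φ` that is an element of `M` has its trace `H ∩ M` in `Ψ`. -/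
def IsGood (Φ Ψ : Set ZFSet.{u}) (M : ZFSet.{u}) : Prop :=
  ∀ H ∈ Φ, H ∈ M → H ∩ M ∈ Ψ

/-- Every chain of length `κ` of models closed under suitable operations has stationarily many
good members. -/
def HasGoodChains (Φ Ψ : Set ZFSet.{u}) (κ : Cardinal.{u}) : Prop :=
  ∃ f : Operations.{u}, ∀ N, IsChain f κ N → IsStationary {i : Set.Iio κ.ord | IsGood Φ Ψ (N i)}

/-- Weak reflection, for a graph that appears at an arbitrary stage of the chain. -/
theorem exists_club_sdiff_mem (hΦ : WeaklyReflecting Φ) (hκ : κ.IsRegular) (hκ' : ℵ₀ < κ)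
    (h : IsChain f κ N) {H : ZFSet.{u}} (hH : H ∈ Φ) {a : Ordinal.{u}} (ha : a < κ.ord)
    (hHa : H ∈ N a) :
    ∃ C : Set (Set.Iio κ.ord), IsClub C ∧ ∀ j ∈ C, a ≤ j.1 ∧ H \ N j ∈ Φ := by
  obtain ⟨T, -, hT⟩ := hΦ
  have hadd : ∀ j : Set.Iio κ.ord, a + j.1 < κ.ord := fun j =>
    Ordinal.isPrincipal_add_ord hκ.aleph0_le ha j.2
  have hcont : IsContinuousSeq (κ := κ) fun j => N (a + j.1) := by
    refine fun i hi x => ⟨fun hx => ?_, ?_⟩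
    · have hlim : Order.IsSuccLimit (a + i.1) := Ordinal.isSuccLimit_add a hi
      obtain ⟨j, hj, hxj⟩ := h.continuous _ (hadd i) hlim x hx
      obtain ⟨k, hk, hjk⟩ : ∃ k < i.1, j ≤ a + k := by
        obtain ⟨k, hk, hjk⟩ := (Ordinal.lt_add_iff hi.ne_bot).1 hj
        exact ⟨k, hk, hjk⟩
      exact ⟨⟨k, hk.trans i.2⟩, hk, h.mono _ _ hjk (hadd ⟨k, hk.trans i.2⟩) hxj⟩
    · rintro ⟨j, hj, hx⟩
      exact h.mono _ _ (by gcongr) (hadd i) hx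
  obtain ⟨C, hC, hCH⟩ := hT κ hκ' hκ (fun j => N (a + j.1))
    (fun i j hij => h.mono _ _ (by gcongr) (hadd i))
    hcont
    (fun i j hij => h.mem (by gcongr) (hadd i))
    (fun i => (h.isModel _ (hadd i)).elementary T)
    (fun i => ⟨h.card_lt _ (hadd i), h.containsOwnCard _ (hadd i)⟩)
    H hH (fun i hi => by rw [hi, add_zero]; exact hHa)
  refine ⟨{j | ∃ i ∈ C, j.1 = a + i.1}, ⟨?_, ?_⟩, ?_⟩
  · intro t ht ht₀ _ x hx
    have hax : a ≤ x.1 := by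
      obtain ⟨y, hy⟩ := ht₀
      obtain ⟨i, -, hi⟩ := ht hy
      exact (hi ▸ le_self_add : a ≤ y.1).trans (hx.1 hy)
    refine ⟨⟨x.1 - a, (Ordinal.sub_le_self _ _).trans_lt x.2⟩, ?_,
      (Ordinal.add_sub_cancel_of_le hax).symm⟩
    refine hC.isLUB_mem (t := {i | i ∈ C ∧ ∃ y ∈ t, y.1 = a + i.1}) (fun i hi => hi.1) ?_ ?_
    · obtain ⟨y, hy⟩ := ht₀
      obtain ⟨i, hiC, hi⟩ := ht hy
      exact ⟨i, hiC, y, hy, hi⟩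
    · constructor
      · rintro i ⟨-, y, hy, hi⟩
        change i.1 ≤ x.1 - a
        rw [← add_le_add_iff_left a, Ordinal.add_sub_cancel_of_le hax, ← hi]
        exact hx.1 hy
      · intro b hb
        change x.1 - a ≤ b.1
        rw [Ordinal.sub_le]
        suffices h' : (⟨a + b.1, hadd b⟩ : Set.Iio κ.ord) ∈ upperBounds t from hx.2 h'
        intro y hy
        obtain ⟨i, hiC, hi⟩ := ht hy
        change y.1 ≤ a + b.1
        rw [hi]
        gcongr
        exact hb ⟨hiC, y, hy, hi⟩
  · intro b
    obtain ⟨c, hc, hbc⟩ := hC.isCofinal b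
    exact ⟨⟨a + c.1, hadd c⟩, ⟨c, hc, rfl⟩, hbc.trans (le_add_self : c.1 ≤ a + c.1)⟩
  · rintro j ⟨i, hi, hj⟩
    refine ⟨hj ▸ le_self_add, ?_⟩
    rw [hj]
    exact hCH i hi

/-- A set cut along a well-ordered family of sets belongs to `Ψ` if all its pieces do. -/
theorem mem_of_pieces_mem (hΨ : ClosedUnderDisjointUnions Ψ) {ι : Type*} [LinearOrder ι]
    [WellFoundedLT ι] [Small.{u} ι] (W : ι → ZFSet.{u}) (H R : ZFSet.{u})
    (hpieces : ∀ j, ∃ P ∈ Ψ, ∀ x, x ∈ P ↔ x ∈ H ∧ x ∈ W j ∧ ∀ i < j, x ∉ W i)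
    (hR : ∀ x, x ∈ R ↔ x ∈ H ∧ ∃ j, x ∈ W j) : R ∈ Ψ := by
  choose P hP hP' using hpieces
  have e : (ZFSet.range P).sUnion = R := by
    ext x
    simp only [ZFSet.mem_sUnion, ZFSet.mem_range, hR]
    constructor
    · rintro ⟨_, ⟨j, rfl⟩, hx⟩
      exact ⟨((hP' j x).1 hx).1, j, ((hP' j x).1 hx).2.1⟩
    · rintro ⟨hxH, hx⟩
      have hmin := wellFounded_lt.min_mem {j | x ∈ W j} hx
      exact ⟨_, ⟨_, rfl⟩, (hP' _ x).2 ⟨hxH, hmin, fun i hi hxi =>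
        wellFounded_lt.not_lt_min {j | x ∈ W j} hxi hi⟩⟩
  rw [← e]
  refine hΨ _ (fun G hG => ?_) (fun G hG K hK hne => ?_)
  · obtain ⟨j, rfl⟩ := ZFSet.mem_range.1 hG
    exact hP j
  · obtain ⟨i, rfl⟩ := ZFSet.mem_range.1 hG
    obtain ⟨j, rfl⟩ := ZFSet.mem_range.1 hK
    rw [ZFSet.eq_empty]
    intro x hx
    obtain ⟨h1, h2⟩ := ZFSet.mem_inter.1 hx
    rw [hP'] at h1 h2
    rcases lt_trichotomy i j with hij | rfl | hij
    · exact h2.2.2 i hij h1.2.1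
    · exact hne rfl
    · exact h1.2.2 j hij h2.2.1

theorem empty_mem_of_closedUnderDisjointUnions (hΨ : ClosedUnderDisjointUnions Ψ) : ∅ ∈ Ψ := by
  have := hΨ ∅ (by simp) (by simp)
  rwa [ZFSet.sUnion_empty] at this

/-- The union of a chain with stationarily many good members is good: cut along the stages that
are good and lie in the club provided by weak reflection. -/
theorem isGood_of_isStationary (hΦ : WeaklyReflecting Φ) (hΨ : ClosedUnderDisjointUnions Ψ)
    (hκ : κ.IsRegular) (hκ' : ℵ₀ < κ) (h : IsChain f κ N)
    (hS : IsStationary {i : Set.Iio κ.ord | IsGood Φ Ψ (N i)}) {K : ZFSet.{u}}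
    (hK : ∀ x, x ∈ K ↔ ∃ i < κ.ord, x ∈ N i) : IsGood Φ Ψ K := by
  intro H hH hHK
  obtain ⟨a, ha, hHa⟩ := (hK H).1 hHK
  obtain ⟨C, hC, hCH⟩ := exists_club_sdiff_mem hΦ hκ hκ' h hH ha hHa
  have hcof := isCofinal_inter_of_isStationary hκ hκ' hS hC
  refine mem_of_pieces_mem hΨ (ι := (C ∩ {i : Set.Iio κ.ord | IsGood Φ Ψ (N i)} : Set _))
    (fun j => N j.1.1) H _ (fun j => ?_) (fun x => ?_)
  · have hHj : H ∈ N j.1.1 := h.mono _ _ (hCH _ j.2.1).1 j.1.2 hHa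
    let t : Set (Set.Iio κ.ord) := {i | i ∈ C ∧ IsGood Φ Ψ (N i) ∧ i < j.1}
    rcases t.eq_empty_or_nonempty with ht | ht
    · refine ⟨H ∩ N j.1.1, j.2.2 H hH hHj, fun x => ?_⟩
      rw [ZFSet.mem_inter]
      refine ⟨fun hx => ⟨hx.1, hx.2, fun i hi => ?_⟩, fun hx => ⟨hx.1, hx.2.1⟩⟩
      have : i.1 ∈ t := ⟨i.2.1, i.2.2, hi⟩
      simp [ht] at this
    · have hbdd : ∃ k : Set.Iio κ.ord, IsLUB t k := by
        have hne : (upperBounds t).Nonempty := ⟨j.1, fun i hi => hi.2.2.le⟩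
        exact ⟨wellFounded_lt.min _ hne, wellFounded_lt.min_mem _ hne, fun b hb =>
          not_lt.1 (wellFounded_lt.not_lt_min _ hb)⟩
      obtain ⟨k, hk⟩ := hbdd
      have hkC : k ∈ C := hC.isLUB_mem (fun i hi => hi.1) ht hk
      have hkj : k ≤ j.1 := hk.2 fun i hi => hi.2.2.le
      have hmem : ∀ x, x ∈ N k ↔ ∃ i < j, x ∈ N i.1.1 := by
        intro x
        constructor
        · intro hx
          obtain ⟨i, hi, hxi⟩ := h.exists_mem_of_isLUB ht hk hx
          exact ⟨⟨i, hi.1, hi.2.1⟩, hi.2.2, hxi⟩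
        · rintro ⟨i, hi, hxi⟩
          exact h.mono _ _ (hk.1 ⟨i.2.1, i.2.2, hi⟩) k.2 hxi
      rcases hkj.eq_or_lt with rfl | hkj
      · refine ⟨∅, empty_mem_of_closedUnderDisjointUnions hΨ, fun x => ?_⟩
        simp only [ZFSet.notMem_empty, false_iff]
        rintro ⟨-, hx, hx'⟩
        obtain ⟨i, hi, hxi⟩ := (hmem x).1 hx
        exact hx' i hi hxi
      · refine ⟨(H \ N k) ∩ N j.1.1, j.2.2 _ (hCH k hkC).2
          ((h.isModel _ j.1.2).sdiff_mem hHj (h.mem hkj j.1.2)), fun x => ?_⟩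
        simp only [ZFSet.mem_inter, ZFSet.mem_sdiff, hmem]
        push Not
        tauto
  · rw [ZFSet.mem_inter, hK]
    refine and_congr_right fun _ => ⟨?_, fun ⟨j, hj⟩ => ⟨_, j.1.2, hj⟩⟩
    rintro ⟨i, hi, hx⟩
    obtain ⟨j, hj, hij⟩ := hcof ⟨i, hi⟩
    exact ⟨⟨j, hj⟩, h.mono _ _ hij j.2 hx⟩

/-! ### Construction of chains -/

/-- The canonical tower of models over the base `b` along a set `A` of ordinals. It grows exactly
at the ordinals `i ∈ A`, where the next model is generated by the current one, the set of all models
obtained so far, and the set `Z i`. -/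
noncomputable def tower (f : Operations.{u}) (A : Set Ordinal.{u}) (Z : Ordinal.{u} → ZFSet.{u})
    (b : ZFSet.{u}) (γ : Ordinal.{u}) : ZFSet.{u} :=
  modelHull f b ∪ ZFSet.iUnion fun i : {i : Set.Iio γ // i.1 ∈ A} =>
    modelHull f (tower f A Z b i.1.1 ∪
      {ZFSet.range (fun k : {k : Set.Iic i.1.1 // k.1 ∈ A} => tower f A Z b k.1.1), Z i.1.1})
termination_by γ
decreasing_by
  · exact i.1.2
  · exact lt_of_le_of_lt k.1.2 i.1.2

section Tower

variable (f : Operations.{u}) (A : Set Ordinal.{u}) (Z : Ordinal.{u} → ZFSet.{u}) (b : ZFSet.{u})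

/-- The set of all models of the tower up to stage `i`. -/
noncomputable def towerHistory (i : Ordinal.{u}) : ZFSet.{u} :=
  ZFSet.range (fun k : {k : Set.Iic i // k.1 ∈ A} => tower f A Z b k.1.1)

/-- The model that the tower adds at `i ∈ A`. -/
noncomputable def towerStep (i : Ordinal.{u}) : ZFSet.{u} :=
  modelHull f (tower f A Z b i ∪ {towerHistory f A Z b i, Z i})

theorem mem_towerHistory {i : Ordinal.{u}} {x : ZFSet.{u}} :
    x ∈ towerHistory f A Z b i ↔ ∃ k ≤ i, k ∈ A ∧ x = tower f A Z b k := by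
  rw [towerHistory, ZFSet.mem_range]
  constructor
  · rintro ⟨k, rfl⟩
    exact ⟨k.1.1, k.1.2, k.2, rfl⟩
  · rintro ⟨k, hk, hkA, rfl⟩
    exact ⟨⟨⟨k, hk⟩, hkA⟩, rfl⟩

theorem mem_tower {γ : Ordinal.{u}} {x : ZFSet.{u}} :
    x ∈ tower f A Z b γ ↔ x ∈ modelHull f b ∨ ∃ i < γ, i ∈ A ∧ x ∈ towerStep f A Z b i := by
  rw [tower, ZFSet.mem_union, ZFSet.mem_iUnion]
  refine or_congr_right ⟨?_, ?_⟩
  · rintro ⟨i, hi⟩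
    exact ⟨i.1.1, i.1.2, i.2, hi⟩
  · rintro ⟨i, hi, hiA, hx⟩
    exact ⟨⟨⟨i, hi⟩, hiA⟩, hx⟩

theorem tower_subset_towerStep (i : Ordinal.{u}) : tower f A Z b i ⊆ towerStep f A Z b i :=
  fun _ hx => subset_modelHull _ _ (ZFSet.mem_union.2 (Or.inl hx))

theorem towerHistory_mem_towerStep (i : Ordinal.{u}) :
    towerHistory f A Z b i ∈ towerStep f A Z b i :=
  subset_modelHull _ _ (ZFSet.mem_union.2 (Or.inr (by simp)))

theorem mem_towerStep (i : Ordinal.{u}) : Z i ∈ towerStep f A Z b i :=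
  subset_modelHull _ _ (ZFSet.mem_union.2 (Or.inr (by simp)))

/-- A stage of the tower depends only on the data below that stage. -/
theorem tower_congr {A A' : Set Ordinal.{u}} {Z Z' : Ordinal.{u} → ZFSet.{u}} {γ : Ordinal.{u}}
    (hA : ∀ i < γ, (i ∈ A ↔ i ∈ A')) (hZ : ∀ i < γ, i ∈ A → Z i = Z' i) :
    tower f A Z b γ = tower f A' Z' b γ := by
  induction γ using WellFoundedLT.induction with
  | ind γ ih =>
    have ih' : ∀ i < γ, tower f A Z b i = tower f A' Z' b i := fun i hi =>
      ih i hi (fun j hj => hA j (hj.trans hi)) (fun j hj => hZ j (hj.trans hi))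
    have hhist : ∀ i < γ, towerHistory f A Z b i = towerHistory f A' Z' b i := by
      intro i hi
      ext x
      simp only [mem_towerHistory]
      refine exists_congr fun k => and_congr_right fun hk => ?_
      rw [hA k (hk.trans_lt hi), ih' k (hk.trans_lt hi)]
    ext x
    simp only [mem_tower]
    refine or_congr_right (exists_congr fun i => and_congr_right fun hi => ?_)
    rw [← hA i hi]
    refine and_congr_right fun hiA => ?_
    rw [towerStep, towerStep, ih' i hi, hhist i hi, hZ i hi hiA]

end Tower

/-- Along a subset of order type `κ`, a tower over a small base is a chain of models. -/
theorem isChain_tower (hκ : κ.IsRegular) (hκ' : ℵ₀ < κ) {c : Ordinal.{u} → Ordinal.{u}}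
    (hc : ∀ i j, i < j → j < κ.ord → c i < c j) (Z : Ordinal.{u} → ZFSet.{u}) {b : ZFSet.{u}}
    (hb : b.card < κ) :
    IsChain f κ fun j => tower f {γ | ∃ i < κ.ord, γ = c i} Z b (c j) := by
  set A : Set Ordinal.{u} := {γ | ∃ i < κ.ord, γ = c i} with hA
  let K : Ordinal.{u} → ZFSet.{u} := fun j => tower f A Z b (c j)
  let S : Ordinal.{u} → ZFSet.{u} := fun j => towerStep f A Z b (c j)
  have hlim := Cardinal.isSuccLimit_ord hκ.aleph0_le
  have hc' : ∀ i j, i < κ.ord → j < κ.ord → (c i < c j ↔ i < j) := fun i j hi hj => by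
    rcases lt_trichotomy i j with h | rfl | h
    · simp [h, hc i j h hj]
    · simp
    · simp [h.not_gt, (hc j i h hi).not_gt]
  have hmem : ∀ j < κ.ord, ∀ x, x ∈ K j ↔ x ∈ modelHull f b ∨ ∃ i < j, x ∈ S i := by
    intro j hj x
    change x ∈ tower f A Z b (c j) ↔ _
    rw [mem_tower]
    refine or_congr_right ⟨?_, ?_⟩
    · rintro ⟨_, hi, ⟨i, hiκ, rfl⟩, hx⟩
      exact ⟨i, (hc' i j hiκ hj).1 hi, hx⟩
    · rintro ⟨i, hi, hx⟩
      exact ⟨c i, hc i j hi hj, ⟨i, hi.trans hj, rfl⟩, hx⟩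
  have hKS : ∀ j, K j ⊆ S j := fun j => tower_subset_towerStep _ _ _ _ _
  have hbK : ∀ j < κ.ord, modelHull f b ⊆ K j := fun j hj x hx => (hmem j hj x).2 (Or.inl hx)
  have hSK : ∀ i j, i < j → j < κ.ord → S i ⊆ K j := fun i j hij hj x hx =>
    (hmem j hj x).2 (Or.inr ⟨i, hij, hx⟩)
  have hSmono : ∀ i j, i ≤ j → j < κ.ord → S i ⊆ S j := by
    intro i j hij hj
    rcases hij.eq_or_lt with rfl | hij
    · exact fun _ h => h
    · exact fun x hx => hKS j (hSK i j hij hj hx)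
  have hKmono : ∀ i j, i ≤ j → j < κ.ord → K i ⊆ K j := by
    intro i j hij hj
    rcases hij.eq_or_lt with rfl | hij
    · exact fun _ h => h
    · exact fun x hx => hSK i j hij hj (hKS i hx)
  have hcov : ∀ j, 0 < j → j < κ.ord → ∀ x, x ∈ K j ↔ ∃ i : Set.Iio j, x ∈ S i := by
    intro j hj0 hj x
    rw [hmem j hj]
    constructor
    · rintro (hx | ⟨i, hi, hx⟩)
      · exact ⟨⟨0, hj0⟩, hKS 0 (hbK 0 (hj0.trans hj) hx)⟩
      · exact ⟨⟨i, hi⟩, hx⟩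
    · rintro ⟨i, hx⟩
      exact Or.inr ⟨i, i.2, hx⟩
  have hK0 : ∀ x, x ∈ K 0 ↔ x ∈ modelHull f b := by
    intro x
    rw [hmem 0 hκ.ord_pos]
    simp
  have hK0' : K 0 = modelHull f b := by
    ext x; exact hK0 x
  have hmodel : ∀ j < κ.ord, IsModel f (K j) := by
    intro j hj
    rcases (zero_le (a := j)).eq_or_lt with rfl | hj0
    · rw [hK0']; exact isModel_modelHull _ _
    · have : Nonempty (Set.Iio j) := ⟨⟨0, hj0⟩⟩
      refine isModel_of_directed (y := fun i : Set.Iio j => S i) (fun i k => ?_)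
        (fun i => isModel_modelHull _ _) (hcov j hj0 hj)
      exact ⟨max i k, hSmono _ _ (le_max_left i k) ((max i k).2.trans hj),
        hSmono _ _ (le_max_right i k) ((max i k).2.trans hj)⟩
  have hinit : ∀ i j, i < j → j < κ.ord → ∃ v ∈ K j, ∀ x, x ∈ v ↔ ∃ k ≤ i, x = K k := by
    intro i j hij hj
    refine ⟨towerHistory f A Z b (c i), hSK i j hij hj (towerHistory_mem_towerStep _ _ _ _ _),
      fun x => ?_⟩
    rw [mem_towerHistory]
    constructor
    · rintro ⟨_, hk, ⟨k, hkκ, rfl⟩, rfl⟩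
      exact ⟨k, not_lt.1 fun h => hk.not_gt (hc i k h hkκ), rfl⟩
    · rintro ⟨k, hk, rfl⟩
      refine ⟨c k, ?_, ⟨k, hk.trans_lt (hij.trans hj), rfl⟩, rfl⟩
      rcases hk.eq_or_lt with rfl | hk
      · exact le_rfl
      · exact (hc k i hk (hij.trans hj)).le
  have hcardS : ∀ j, (K j).card < κ → (S j).card < κ := by
    intro j hj
    change (modelHull f _).card < κ
    rw [card_modelHull]
    refine max_lt hκ' (ZFSet.card_union_le.trans_lt (Cardinal.add_lt_of_lt hκ.aleph0_le hj ?_))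
    exact (ZFSet.card_insert_le.trans_lt (by
      rw [ZFSet.card_singleton, one_add_one_eq_two]
      exact (Cardinal.natCast_lt_aleph0 (n := 2)).trans hκ'))
  have hcard : ∀ j < κ.ord, (K j).card < κ := by
    intro j
    induction j using WellFoundedLT.induction with
    | ind j ih =>
      intro hj
      rcases (zero_le (a := j)).eq_or_lt with rfl | hj0
      · rw [hK0', card_modelHull]; exact max_lt hκ' hb
      · refine card_lt_of_cover (ι := Set.Iio j) hκ ?_
          (fun i => hcardS i (ih i i.2 (lt_trans i.2 hj))) (fun x hx => (hcov j hj0 hj x).1 hx)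
        rw [Cardinal.mk_Iio_ordinal, Cardinal.lift_lt]
        exact Cardinal.lt_ord.1 hj
  have hKmem : ∀ i j, i < j → j < κ.ord → K i ∈ K j := by
    intro i j hij hj
    obtain ⟨v, hv, hv'⟩ := hinit i j hij hj
    have e : v.sUnion = K i := by
      ext x
      rw [ZFSet.mem_sUnion]
      constructor
      · rintro ⟨y, hy, hx⟩
        obtain ⟨k, hk, rfl⟩ := (hv' y).1 hy
        exact hKmono k i hk (hij.trans hj) hx
      · exact fun hx => ⟨K i, (hv' _).2 ⟨i, le_rfl, rfl⟩, hx⟩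
    exact e ▸ (hmodel j hj).sUnion_mem hv
  refine ⟨hmodel, hKmono, fun j hj hjlim x hx => ?_, hinit, hcard, fun j hj => ?_⟩
  · obtain ⟨i, hi⟩ := (hcov j hjlim.bot_lt hj x).1 hx
    exact ⟨Order.succ i.1, hjlim.succ_lt i.2,
      hSK i _ (Order.lt_succ _) ((hjlim.succ_lt i.2).trans hj) hi⟩
  · rcases (zero_le (a := j)).eq_or_lt with rfl | hj0
    · change ContainsOwnCard (K 0)
      rw [hK0']; exact containsOwnCard_modelHull _ _
    -- An ordinal below the cardinality of the union is below the length of the union or below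
    -- the cardinality of one of its terms.
    intro z hz
    change z ∈ (K j).card.ord.toZFSet at hz
    change z ∈ K j
    obtain ⟨o, ho, rfl⟩ := Ordinal.mem_toZFSet_iff.1 hz
    by_contra hno
    have hjo : j ≤ o := by
      by_contra! hlt
      exact hno (toZFSet_mem_of_lt_leastMissing (hlt.trans_le (le_leastMissing hKmono
        (fun i j hij hj => (hmodel j hj).leastMissing_mem (hKmem i j hij hj)) hj)))
    have hSo : ∀ i : Set.Iio j, (S i).card ≤ o.card := by
      intro i
      by_contra! hlt
      refine hno (hSK i j i.2 hj (containsOwnCard_modelHull _ _ ?_))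
      exact Ordinal.toZFSet_mem_toZFSet_iff.2 (Cardinal.lt_ord.2 hlt)
    have hinf : ℵ₀ ≤ o.card := by
      refine le_trans ?_ (hSo ⟨0, hj0⟩)
      change ℵ₀ ≤ (modelHull f _).card
      rw [card_modelHull]
      exact le_max_left _ _
    refine (Cardinal.lt_ord.1 ho).not_ge (card_le_of_cover (ι := Set.Iio j) hinf ?_ hSo
      (fun x hx => (hcov j hj0 hj x).1 hx))
    rw [Cardinal.mk_Iio_ordinal, Cardinal.lift_le]
    exact Ordinal.card_le_card hjo

/-- Chains exist over every small set. -/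
theorem exists_isChain (f : Operations.{u}) (hκ : κ.IsRegular) (hκ' : ℵ₀ < κ) {b : ZFSet.{u}}
    (hb : b.card < κ) : ∃ N, IsChain f κ N ∧ ∀ i < κ.ord, b ⊆ N i :=
  ⟨_, isChain_tower hκ hκ' (c := id) (fun _ _ h _ => h) (fun _ => ∅) hb,
    fun _ _ _ hx => (mem_tower _ _ _ _).2 (Or.inl (subset_modelHull _ _ hx))⟩

/-- If chains of length `ν⁺` have good members, then every set of cardinality at most `ν` is
contained in a good model of cardinality `ν` that in addition splits off a remainder in `Φ`. -/
theorem exists_good_model (hΦ : WeaklyReflecting Φ) (f : Operations.{u}) {ν : Cardinal.{u}}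
    (hν : ℵ₀ ≤ ν) (hgood : HasGoodChains Φ Ψ (Order.succ ν)) {H A : ZFSet.{u}} (hH : H ∈ Φ)
    (hA : A.card ≤ ν) :
    ∃ K, IsModel f K ∧ A ⊆ K ∧ H ∈ K ∧ K.card = ν ∧ ContainsOwnCard K ∧ IsGood Φ Ψ K ∧
      H \ K ∈ Φ := by
  obtain ⟨g, hg⟩ := hgood
  have hreg := Cardinal.isRegular_succ hν
  have hunc : ℵ₀ < Order.succ ν := hν.trans_lt (Order.lt_succ ν)
  obtain ⟨N, hN, hbN⟩ := exists_isChain (f.union g) hreg hunc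
    (b := insert H (A ∪ ν.ord.toZFSet)) (Order.lt_succ_of_le (card_insert_le_of_infinite hν
      (card_union_le_of_infinite hν hA (card_toZFSet_ord ν).le)))
  have hH0 : H ∈ N 0 := hbN 0 hreg.ord_pos (by simp)
  obtain ⟨C, hC, hCH⟩ := exists_club_sdiff_mem hΦ hreg hunc hN hH hreg.ord_pos hH0
  have hN' : IsChain g (Order.succ ν) N := hN.sub fun M hM =>
    Operations.isClosed_union.2 ⟨hM.base, (Operations.isClosed_union.1 hM.operations).2⟩
  obtain ⟨i, hi, hiC⟩ := hg N hN' hC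
  have hsub := hbN i i.2
  refine ⟨N i, (hN.isModel i i.2).mono, fun x hx => hsub (by simp [hx]), hsub (by simp),
    le_antisymm (Order.lt_succ_iff.1 (hN.card_lt i i.2)) ?_, hN.containsOwnCard i i.2, hi,
    (hCH i hiC).2⟩
  conv_lhs => rw [← card_toZFSet_ord ν]
  exact ZFSet.card_mono fun _ hx => hsub (by simp [hx])

/-! ### Chains of length `ℵ₁` and chains of weakly inaccessible length -/

theorem hasGoodChains_aleph_one (hΦ : WeaklyReflecting Φ)
    (hcountable : ∀ G ∈ Φ, G.card ≤ ℵ₀ → G ∈ Ψ) : HasGoodChains Φ Ψ ℵ₁ := by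
  obtain ⟨T, hT, -⟩ := hΦ
  refine ⟨Operations.empty, fun N hN => ?_⟩
  have hle : ∀ i : Set.Iio (ℵ₁ : Cardinal.{u}).ord, (N i).card ≤ ℵ₀ := fun i =>
    Order.lt_succ_iff.1 ((hN.card_lt i i.2).trans_eq Cardinal.succ_aleph0.symm)
  have : {i : Set.Iio (ℵ₁ : Cardinal.{u}).ord | IsGood Φ Ψ (N i)} = Set.univ := by
    refine Set.eq_univ_of_forall fun i H hH hHN => hcountable _
      (hT _ ((hN.isModel i i.2).elementary T) (hle i) H hH hHN) ?_
    exact (ZFSet.card_mono fun x hx => (ZFSet.mem_inter.1 hx).2).trans (hle i)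
  rw [this]
  have : Nonempty (Set.Iio (ℵ₁ : Cardinal.{u}).ord) :=
    ⟨⟨0, Cardinal.isRegular_aleph_one.ord_pos⟩⟩
  exact IsStationary.univ

/-- A uniform choice of good models, for all small sets of parameters. -/
theorem exists_goodHull (hΦ : WeaklyReflecting Φ) (f : Operations.{u}) (hκ' : ℵ₀ < κ)
    (ih : ∀ ν, ℵ₀ ≤ ν → ν < κ → HasGoodChains Φ Ψ (Order.succ ν)) :
    ∃ G : ZFSet.{u} → ZFSet.{u} → ZFSet.{u}, ∀ H ∈ Φ, ∀ A : ZFSet.{u}, A.card < κ →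
      IsModel f (G H A) ∧ A ⊆ G H A ∧ H ∈ G H A ∧ (G H A).card = max ℵ₀ A.card ∧
      ContainsOwnCard (G H A) ∧ IsGood Φ Ψ (G H A) ∧ H \ G H A ∈ Φ := by
  have key : ∀ H A : ZFSet.{u}, ∃ K : ZFSet.{u}, H ∈ Φ → A.card < κ →
      IsModel f K ∧ A ⊆ K ∧ H ∈ K ∧ K.card = max ℵ₀ A.card ∧
      ContainsOwnCard K ∧ IsGood Φ Ψ K ∧ H \ K ∈ Φ := by
    intro H A
    by_cases hH : H ∈ Φ ∧ A.card < κ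
    · obtain ⟨K, hK⟩ := exists_good_model hΦ f (le_max_left _ _)
        (ih (max ℵ₀ A.card) (le_max_left _ _) (max_lt hκ' hH.2)) hH.1 (le_max_right _ _)
      exact ⟨K, fun _ _ => hK⟩
    · exact ⟨∅, fun h1 h2 => absurd ⟨h1, h2⟩ hH⟩
  choose G hG using key
  exact ⟨G, fun H hH A hA => hG H A hH hA⟩

/-- A set is in `Ψ` if its differences along an increasing `ω`-sequence of sets are. The set `L` is
removed from everything. -/
theorem mem_of_increasing_sequence (hΨ : ClosedUnderDisjointUnions Ψ) {K : ℕ → ZFSet.{u}}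
    (hmono : ∀ n, K n ⊆ K (n + 1)) {H L R : ZFSet.{u}} (h0 : (H ∩ K 0) \ L ∈ Ψ)
    (hsucc : ∀ n, ((H \ K n) ∩ K (n + 1)) \ L ∈ Ψ)
    (hR : ∀ x, x ∈ R ↔ x ∈ H ∧ x ∉ L ∧ ∃ n, x ∈ K n) : R ∈ Ψ := by
  have hm : ∀ m n, m ≤ n → K m ⊆ K n := by
    intro m n hmn
    induction n, hmn using Nat.le_induction with
    | base => exact fun _ h => h
    | succ n _ ih => exact fun x hx => hmono n (ih hx)
  refine mem_of_pieces_mem hΨ K (H \ L) R (fun n => ?_) (fun x => ?_)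
  · rcases n with _ | n
    · refine ⟨_, h0, fun x => ?_⟩
      simp only [ZFSet.mem_sdiff, ZFSet.mem_inter, Nat.not_lt_zero, false_implies, implies_true]
      tauto
    · refine ⟨_, hsucc n, fun x => ?_⟩
      have : (∀ i < n + 1, x ∉ K i) ↔ x ∉ K n :=
        ⟨fun h => h n n.lt_succ_self, fun h i hi hx => h (hm i n (Nat.lt_succ_iff.1 hi) hx)⟩
      simp only [ZFSet.mem_sdiff, ZFSet.mem_inter, this]
      tauto
  · rw [hR, ZFSet.mem_sdiff, and_assoc]

/-- A chain whose length is a regular limit cardinal has good members at suitable stages of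
cofinality `ω`: inside such a member there is an increasing `ω`-sequence of good models that
exhausts it. -/
theorem hasGoodChains_of_limit (hΦ : WeaklyReflecting Φ) (hΨ : ClosedUnderDisjointUnions Ψ)
    (hκ : κ.IsRegular) (hκ' : ℵ₀ < κ)
    (ih : ∀ ν, ℵ₀ ≤ ν → ν < κ → HasGoodChains Φ Ψ (Order.succ ν)) : HasGoodChains Φ Ψ κ := by
  obtain ⟨G, hG⟩ := exists_goodHull hΦ Operations.empty hκ' ih
  refine ⟨Operations.binary G, fun N hN D hD => ?_⟩
  obtain ⟨s, α, hαD, -, -, hsα, hcov, hsub⟩ := hN.exists_omega_stage hκ hκ' hD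
    ⟨0, hκ.ord_pos⟩
  refine ⟨α, ?_, hαD⟩
  have hα := hN.isModel α α.2
  intro H hH hHα
  let K : ℕ → ZFSet.{u} := fun n => Nat.rec (G H ∅) (fun n K => G H (insert K (K ∪ N (s n)))) n
  have hK : ∀ n, K (n + 1) = G H (insert (K n) (K n ∪ N (s n))) := fun _ => rfl
  have hsκ : ∀ n, s n < κ.ord := fun n => (hsα n).trans α.2
  have hstep : ∀ n, (K n).card < κ → (insert (K n) (K n ∪ N (s n)) : ZFSet).card < κ := by
    intro n hn
    exact ZFSet.card_insert_le.trans_lt (Cardinal.add_lt_of_lt hκ.aleph0_le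
      (ZFSet.card_union_le.trans_lt (Cardinal.add_lt_of_lt hκ.aleph0_le hn
        (hN.card_lt _ (hsκ n)))) (Cardinal.one_lt_aleph0.trans hκ'))
  have hKcard : ∀ n, (K n).card < κ := by
    intro n
    induction n with
    | zero =>
      have h0 : (∅ : ZFSet.{u}).card < κ := by simpa using hκ.pos
      rw [show K 0 = G H ∅ from rfl, (hG H hH ∅ h0).2.2.2.1]
      exact max_lt hκ' h0
    | succ n ih =>
      rw [hK, (hG H hH _ (hstep n ih)).2.2.2.1]
      exact max_lt hκ' (hstep n ih)
  have hcard : ∀ n, (insert (K n) (K n ∪ N (s n)) : ZFSet).card < κ := fun n =>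
    hstep n (hKcard n)
  have hspec : ∀ n, ∃ A : ZFSet.{u}, A.card < κ ∧ K n = G H A := by
    rintro (_ | n)
    · exact ⟨∅, by simpa using hκ.pos, rfl⟩
    · exact ⟨_, hcard n, rfl⟩
  have hmodel : ∀ n, IsModel Operations.empty (K n) ∧ H ∈ K n ∧ IsGood Φ Ψ (K n) ∧
      H \ K n ∈ Φ := by
    intro n
    obtain ⟨A, hA, e⟩ := hspec n
    rw [e]
    obtain ⟨h1, -, h2, -, -, h3, h4⟩ := hG H hH A hA
    exact ⟨h1, h2, h3, h4⟩
  have hsubset : ∀ n, (insert (K n) (K n ∪ N (s n)) : ZFSet) ⊆ K (n + 1) := fun n =>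
    (hG H hH _ (hcard n)).2.1
  have hKα : ∀ n, K n ∈ N α := by
    intro n
    have hop := hα.operations
    induction n with
    | zero =>
      refine hop.binary hHα ?_
      simpa using hN.toZFSet_mem α.2 ((zero_le (a := s 0)).trans_lt (hsα 0))
    | succ n ih =>
      rw [hK]
      exact hop.binary hHα (hα.insert_mem ih (hα.union_mem ih (hN.mem (hsα n) α.2)))
  refine mem_of_increasing_sequence hΨ (K := K) (H := H) (L := ∅)
    (fun n x hx => hsubset n (by simp [hx])) ?_ (fun n => ?_) (fun x => ?_)
  · have := (hmodel 0).2.2.1 H hH (hmodel 0).2.1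
    convert this using 1
    ext; simp
  · have := (hmodel (n + 1)).2.2.1 _ (hmodel n).2.2.2
      ((hmodel (n + 1)).1.sdiff_mem (hmodel (n + 1)).2.1 (hsubset n (by simp)))
    convert this using 1
    ext; simp
  · simp only [ZFSet.mem_inter, ZFSet.notMem_empty, not_false_eq_true, true_and]
    refine and_congr_right fun _ => ⟨fun hx => ?_, ?_⟩
    · obtain ⟨n, hn⟩ := hcov x hx
      exact ⟨n + 1, hsubset n (by simp [hn])⟩
    · rintro ⟨n, hx⟩
      exact hsub _ (hKα n) (hKcard n) hx

/-! ### Chains whose length is the successor of a singular cardinal -/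

/-- A singular cardinal is the supremum of a set of cardinals all of which bound the size of that
set. -/
theorem exists_cofinal_cardinals {μ : Cardinal.{u}} (hμ : μ.IsSingular) :
    ∃ B : Set Cardinal.{u}, Small.{u} B ∧
      (∀ ν ∈ B, ℵ₀ ≤ ν ∧ ν < μ ∧ #B ≤ Cardinal.lift.{u + 1} ν) ∧ ∀ τ < μ, ∃ ν ∈ B, τ < ν := by
  have hℵ : ℵ₀ < μ := lt_of_le_of_ne hμ.aleph0_le fun h => not_isSingular_aleph0 (h ▸ hμ)
  obtain ⟨s, hs, hs'⟩ := Order.exists_cof_eq (Set.Iio μ.ord)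
  have hcard : #s = Cardinal.lift.{u + 1} μ.ord.cof := by
    rw [hs', Ordinal.cof_Iio, ← Ordinal.lift_cof]
  refine ⟨(fun i : Set.Iio μ.ord => max i.1.card (max ℵ₀ μ.ord.cof)) '' s, inferInstance, ?_, ?_⟩
  · rintro _ ⟨i, -, rfl⟩
    refine ⟨(le_max_left _ _).trans (le_max_right _ _),
      max_lt (Cardinal.lt_ord.1 i.2) (max_lt hℵ hμ.cof_ord_lt), Cardinal.mk_image_le.trans ?_⟩
    rw [hcard, Cardinal.lift_le]
    exact (le_max_right _ _).trans (le_max_right _ _)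
  · intro τ hτ
    obtain ⟨i, hi, hτi⟩ := hs ⟨(Order.succ τ).ord,
      ord_lt_ord.2 (hμ.isSuccLimit.succ_lt hτ)⟩
    refine ⟨_, ⟨i, hi, rfl⟩, lt_max_of_lt_left (Order.succ_le_iff.1 ?_)⟩
    exact Cardinal.ord_le.1 hτi

/-- Suppose that `K ν n` are good models of cardinality `ν`, where `n` is a natural number and `ν`
ranges over a set `B` of at most `min B` cardinals, and that each of these models belongs to all
models with larger second index. Then the trace of `H` on their union belongs to `Ψ`. The rows
`⋃ₙ K ν n` are cut off one after another; well-reflection of `Ψ` is used to remove the union of the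
previous rows from the traces of the good models in a row. -/
theorem mem_of_matrix (hΨ : ClosedUnderDisjointUnions Ψ) (hwell : WellReflecting Ψ)
    {B : Set Cardinal.{u}} [Small.{u} B]
    (hB : ∀ ν ∈ B, ℵ₀ ≤ ν ∧ #B ≤ Cardinal.lift.{u + 1} ν) {K : B → ℕ → ZFSet.{u}}
    {H R : ZFSet.{u}} (hKmodel : ∀ ν n, IsModel f (K ν n)) (hKH : ∀ ν n, H ∈ K ν n)
    (hKcard : ∀ ν n, (K ν n).card = ν) (hKown : ∀ ν n, ContainsOwnCard (K ν n))
    (hKgood : ∀ ν n, IsGood Φ Ψ (K ν n)) (hH : H ∈ Φ) (hKΦ : ∀ ν n, H \ K ν n ∈ Φ)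
    (hKsucc : ∀ ν ν' n, K ν n ∈ K ν' (n + 1))
    (hR : ∀ x, x ∈ R ↔ x ∈ H ∧ ∃ ν n, x ∈ K ν n) : R ∈ Ψ := by
  obtain ⟨T, hT⟩ := hwell
  have hstep : ∀ (ν ν' : B) (n : ℕ), ν ≤ ν' → K ν n ⊆ K ν' (n + 1) := fun ν ν' n h =>
    (hKmodel ν' (n + 1)).subset_of_mem_of_card_le (hKown _ _) (hKsucc _ _ _)
      (by rw [hKcard, hKcard]; exact h)
  have hKmono : ∀ ν m n, m ≤ n → K ν m ⊆ K ν n := by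
    intro ν m n hmn
    induction n, hmn using Nat.le_induction with
    | base => exact fun _ h => h
    | succ n _ ih => exact fun x hx => hstep ν ν n le_rfl (ih hx)
  have hKsub : ∀ ν ν' m n, ν ≤ ν' → m < n → K ν m ⊆ K ν' n := fun ν ν' m n h hmn x hx =>
    hKmono ν' (m + 1) n hmn (hstep ν ν' m h hx)
  -- The rows of the matrix, and the unions of the rows with smaller index.
  let M : B → ZFSet.{u} := fun ν => ZFSet.iUnion fun n : ℕ => K ν n
  let L : B → ZFSet.{u} := fun ν => ZFSet.iUnion fun p : Set.Iio ν × ℕ => K p.1 p.2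
  have hM : ∀ ν x, x ∈ M ν ↔ ∃ n, x ∈ K ν n := fun ν x => ZFSet.mem_iUnion
  have hL : ∀ ν x, x ∈ L ν ↔ ∃ p : Set.Iio ν × ℕ, x ∈ K p.1 p.2 := fun ν x => ZFSet.mem_iUnion
  have hLown : ∀ ν, ContainsOwnCard (L ν) := by
    intro ν z hz
    obtain ⟨o, ho, rfl⟩ := Ordinal.mem_toZFSet_iff.1 hz
    by_contra hno
    have hle : ∀ p : Set.Iio ν × ℕ, (K p.1 p.2).card ≤ o.card := by
      intro p
      by_contra! h
      refine hno ((hL ν _).2 ⟨p, hKown _ _ ?_⟩)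
      exact Ordinal.toZFSet_mem_toZFSet_iff.2 (Cardinal.lt_ord.2 h)
    obtain ⟨p⟩ : Nonempty (Set.Iio ν × ℕ) := by
      by_contra hemp
      have : L ν = ∅ := by
        rw [ZFSet.eq_empty]
        intro x hx
        obtain ⟨p, -⟩ := (hL ν x).1 hx
        exact hemp ⟨p⟩
      rw [this] at ho
      simp at ho
    have hpo : p.1.1.1 ≤ o.card := by rw [← hKcard p.1.1 p.2]; exact hle p
    have hinf : ℵ₀ ≤ o.card := (hB _ p.1.1.2).1.trans hpo
    refine (Cardinal.lt_ord.1 ho).not_ge (card_le_of_cover hinf ?_ hle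
      (fun x hx => (hL ν x).1 hx))
    rw [Cardinal.mk_prod, Cardinal.mk_nat, Cardinal.lift_aleph0, Cardinal.lift_uzero]
    have hinf' := Cardinal.aleph0_le_lift.{u, u + 1}.2 hinf
    refine Cardinal.mul_le_of_le hinf' ((Cardinal.mk_set_le _).trans ?_) hinf'
    exact (hB _ p.1.1.2).2.trans (Cardinal.lift_le.2 hpo)
  have hsplit : ∀ (ν : B), ∀ P ∈ Ψ, (∃ n, ∀ ν' : B, P ∈ K ν' n) → P \ L ν ∈ Ψ := by
    rintro ν P hP ⟨n, hPn⟩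
    by_cases hne : Nonempty (Set.Iio ν)
    · have hmodel : IsModel f (L ν) := by
        refine isModel_of_directed (y := fun p : Set.Iio ν × ℕ => K p.1 p.2) (fun p q => ?_)
          (fun p => hKmodel _ _) (hL ν)
        refine ⟨(max p.1 q.1, max p.2 q.2 + 1), hKsub _ _ _ _ (le_max_left p.1 q.1) ?_,
          hKsub _ _ _ _ (le_max_right p.1 q.1) ?_⟩
        · exact Nat.lt_succ_of_le (le_max_left _ _)
        · exact Nat.lt_succ_of_le (le_max_right _ _)
      obtain ⟨i⟩ := hne
      exact (hT _ (hmodel.elementary T) (hLown ν) P hP ((hL ν P).2 ⟨(i, n), hPn _⟩)).2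
    · have : L ν = ∅ := by
        rw [ZFSet.eq_empty]
        intro x hx
        obtain ⟨p, -⟩ := (hL ν x).1 hx
        exact hne ⟨p.1⟩
      rw [this]
      convert hP using 1
      ext; simp
  refine mem_of_pieces_mem hΨ M H R (fun ν => ?_) (fun x => ?_)
  · refine ⟨(H ∩ M ν) \ L ν, ?_, fun x => ?_⟩
    · refine mem_of_increasing_sequence hΨ (K := K ν) (H := H) (L := L ν)
        (fun n => hstep ν ν n le_rfl) ?_ (fun n => ?_) (fun x => ?_)
      · exact hsplit ν _ (hKgood ν 0 H hH (hKH ν 0))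
          ⟨1, fun ν' => (hKmodel ν' 1).inter_mem (hKH ν' 1) (hKsucc ν ν' 0)⟩
      · refine hsplit ν _ (hKgood ν (n + 1) _ (hKΦ ν n)
          ((hKmodel _ _).sdiff_mem (hKH _ _) (hKsucc _ _ _))) ⟨n + 2, fun ν' => ?_⟩
        exact (hKmodel _ _).inter_mem ((hKmodel _ _).sdiff_mem (hKH _ _)
          (hKmono ν' _ _ (Nat.le_succ _) (hKsucc ν ν' n))) (hKsucc ν ν' (n + 1))
      · rw [ZFSet.mem_sdiff, ZFSet.mem_inter, hM]
        tauto
    · have : (∀ i < ν, x ∉ M i) ↔ x ∉ L ν := by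
        rw [hL]
        simp only [hM]
        constructor
        · rintro h ⟨p, hp⟩
          exact h p.1 p.1.2 ⟨p.2, hp⟩
        · rintro h i hi ⟨n, hn⟩
          exact h ⟨(⟨i, hi⟩, n), hn⟩
      rw [this, ZFSet.mem_sdiff, ZFSet.mem_inter, and_assoc]
  · rw [hR]
    simp only [hM]

/-- A chain of length `μ⁺`, for singular `μ`, has good members at suitable stages of cofinality `ω`:
such a member is exhausted by a matrix of good models of cardinalities less than `μ`. -/
theorem hasGoodChains_succ_of_isSingular (hΦ : WeaklyReflecting Φ)
    (hΨ : ClosedUnderDisjointUnions Ψ) (hwell : WellReflecting Ψ) {μ : Cardinal.{u}}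
    (hμ : μ.IsSingular) (ih : ∀ ν, ℵ₀ ≤ ν → ν < μ → HasGoodChains Φ Ψ (Order.succ ν)) :
    HasGoodChains Φ Ψ (Order.succ μ) := by
  have hℵ : ℵ₀ < μ := lt_of_le_of_ne hμ.aleph0_le fun h => not_isSingular_aleph0 (h ▸ hμ)
  have hreg := Cardinal.isRegular_succ hμ.aleph0_le
  have hunc : ℵ₀ < Order.succ μ := hℵ.trans (Order.lt_succ μ)
  obtain ⟨B, hBsmall, hB, hBcof⟩ := exists_cofinal_cardinals hμ
  obtain ⟨G, hG⟩ := exists_goodHull hΦ Operations.empty hℵ ih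
  let F : ZFSet.{u} → ZFSet.{u} → ZFSet.{u} → ZFSet.{u} := fun y n H =>
    ZFSet.range fun ν : B => G H (ν.1.ord.toZFSet ∪ insert n y)
  refine ⟨Operations.ternary F, fun N hN D hD => ?_⟩
  obtain ⟨s, α, hαD, -, -, hsα, hcov, hsub⟩ := hN.exists_omega_stage hreg hunc hD
    ⟨0, hreg.ord_pos⟩
  refine ⟨α, ?_, hαD⟩
  have hα := hN.isModel α α.2
  intro H hH hHα
  have hsκ : ∀ n, s n < (Order.succ μ).ord := fun n => (hsα n).trans α.2
  let Y : ℕ → ZFSet.{u} := fun n => Nat.rec ∅ (fun n y => F y (N (s n)) H) n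
  let K : B → ℕ → ZFSet.{u} := fun ν n => G H (ν.1.ord.toZFSet ∪ insert (N (s n)) (Y n))
  have hY : ∀ n x, x ∈ Y (n + 1) ↔ ∃ ν, x = K ν n := by
    intro n x
    change x ∈ ZFSet.range _ ↔ _
    rw [ZFSet.mem_range]
    exact exists_congr fun ν => eq_comm
  have hYcard : ∀ n (ν : B), (Y n).card ≤ ν := by
    rintro (_ | n) ν
    · change (∅ : ZFSet.{u}).card ≤ _
      simp
    · have := ZFSet.lift_card_range_le (f := fun ν : B => K ν n)
      rw [Cardinal.lift_id'.{u, u + 1}] at this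
      exact Cardinal.lift_le.1 (this.trans (hB ν.1 ν.2).2.2)
  have harg : ∀ (ν : B) n, (ν.1.ord.toZFSet ∪ insert (N (s n)) (Y n)).card = ν.1 := by
    intro ν n
    refine le_antisymm (card_union_le_of_infinite (hB ν.1 ν.2).1 (card_toZFSet_ord _).le
      (card_insert_le_of_infinite (hB ν.1 ν.2).1 (hYcard n ν))) ?_
    conv_lhs => rw [← card_toZFSet_ord ν.1]
    exact ZFSet.card_mono fun x hx => ZFSet.mem_union.2 (Or.inl hx)
  have hK := fun (ν : B) n => hG H hH (ν.1.ord.toZFSet ∪ insert (N (s n)) (Y n))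
    (by rw [harg]; exact (hB ν.1 ν.2).2.1)
  have hKmodel : ∀ ν n, IsModel Operations.empty (K ν n) := fun ν n => (hK ν n).1
  have hKord : ∀ (ν : B) n, ν.1.ord.toZFSet ⊆ K ν n := fun ν n x hx =>
    (hK ν n).2.1 (ZFSet.mem_union.2 (Or.inl hx))
  have hKN : ∀ ν n, N (s n) ∈ K ν n := fun ν n =>
    (hK ν n).2.1 (ZFSet.mem_union.2 (Or.inr (by simp)))
  have hKY : ∀ ν n, Y n ⊆ K ν n := fun ν n x hx =>
    (hK ν n).2.1 (ZFSet.mem_union.2 (Or.inr (by simp [hx])))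
  have hKH : ∀ ν n, H ∈ K ν n := fun ν n => (hK ν n).2.2.1
  have hKcard : ∀ ν n, (K ν n).card = ν := fun ν n => by
    have := (hK ν n).2.2.2.1
    rw [harg, max_eq_right (hB ν.1 ν.2).1] at this
    exact this
  have hKown : ∀ ν n, ContainsOwnCard (K ν n) := fun ν n => (hK ν n).2.2.2.2.1
  have hKgood : ∀ ν n, IsGood Φ Ψ (K ν n) := fun ν n => (hK ν n).2.2.2.2.2.1
  have hKΦ : ∀ ν n, H \ K ν n ∈ Φ := fun ν n => (hK ν n).2.2.2.2.2.2
  have hKsucc : ∀ ν ν' n, K ν n ∈ K ν' (n + 1) := fun ν ν' n =>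
    hKY ν' (n + 1) ((hY n _).2 ⟨ν, rfl⟩)
  -- The matrix consists of subsets of the model at `α`.
  have hlt : ∀ {ν : B} {c : Cardinal.{u}}, c ≤ ν → c < Order.succ μ := fun {ν c} h =>
    Order.lt_succ_of_le (h.trans (hB ν.1 ν.2).2.1.le)
  obtain ⟨ν₀, hν₀, -⟩ := hBcof ℵ₀ hℵ
  have hYα : ∀ n, Y n ∈ N α := by
    intro n
    induction n with
    | zero =>
      change ∅ ∈ N α
      simpa using hN.toZFSet_mem α.2 ((zero_le (a := s 0)).trans_lt (hsα 0))
    | succ n ih =>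
      exact hα.operations.ternary ih (hN.mem (hsα n) α.2) hHα
  have hKα : ∀ ν n, K ν n ⊆ N α := fun ν n =>
    hsub _ (hsub _ (hYα (n + 1)) (hlt (ν := ⟨ν₀, hν₀⟩) (hYcard (n + 1) _)) ((hY n _).2 ⟨ν, rfl⟩))
      (hlt (ν := ν) (hKcard ν n).le)
  have hNα : ∀ x ∈ N α, ∃ ν n, x ∈ K ν n := by
    intro x hx
    obtain ⟨n, hxn⟩ := hcov x hx
    have hi : (indexIn (N (s n)) x).card < μ := Cardinal.lt_ord.1 ((indexIn_lt hxn).trans_le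
      (ord_le_ord.2 (Order.lt_succ_iff.1 (hN.card_lt _ (hsκ n)))))
    obtain ⟨ν, hν, hlt⟩ := hBcof _ hi
    refine ⟨⟨ν, hν⟩, n, ?_⟩
    rw [← enumSet_indexIn hxn]
    exact (hKmodel _ _).enumSet_mem (hKN _ _)
      (hKord _ _ (Ordinal.toZFSet_mem_toZFSet_iff.2 (Cardinal.lt_ord.2 hlt)))
  refine mem_of_matrix hΨ hwell (fun ν hν => ⟨(hB ν hν).1, (hB ν hν).2.2⟩) hKmodel hKH hKcard hKown
    hKgood hH hKΦ hKsucc (fun x => ?_)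
  rw [ZFSet.mem_inter]
  exact and_congr_right fun _ => ⟨hNα x, fun ⟨ν, n, hn⟩ => hKα ν n hn⟩

/-! ### Chains of length `κ⁺` and approachability -/

theorem exists_increasing_enumeration {o δ : Ordinal.{u}} {c : Set (Set.Iio δ)}
    (hc : Ordinal.type (fun x y : c => x < y) = Ordinal.lift.{u + 1} o) :
    ∃ e : Ordinal.{u} → Ordinal.{u}, (∀ i j, i < j → j < o → e i < e j) ∧
      ∀ γ, (∃ i < o, γ = e i) ↔ ∃ η ∈ c, η.1 = γ := by
  rw [← Ordinal.type_lt_Iio] at hc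
  obtain ⟨r⟩ := Ordinal.type_eq.1 hc.symm
  have key : ∀ i, ∃ γ : Ordinal.{u}, ∀ h : i < o, γ = (r ⟨i, h⟩).1.1 := by
    intro i
    by_cases h : i < o
    · exact ⟨(r ⟨i, h⟩).1.1, fun _ => rfl⟩
    · exact ⟨0, fun h' => absurd h' h⟩
  choose e he using key
  refine ⟨e, fun i j hij hj => ?_, fun γ => ⟨?_, ?_⟩⟩
  · rw [he i (hij.trans hj), he j hj]
    exact r.map_rel_iff.2 (show (⟨i, hij.trans hj⟩ : Set.Iio o) < ⟨j, hj⟩ from hij)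
  · rintro ⟨i, hi, rfl⟩
    exact ⟨_, (r ⟨i, hi⟩).2, (he i hi).symm⟩
  · rintro ⟨η, hη, rfl⟩
    refine ⟨(r.symm ⟨η, hη⟩).1, (r.symm ⟨η, hη⟩).2, ?_⟩
    rw [he _ (r.symm ⟨η, hη⟩).2]
    simp

/-- The union of all members of `t` that do not contain the ordinal `γ`. -/
noncomputable def unionOmitting (t : ZFSet.{u}) (γ : Ordinal.{u}) : ZFSet.{u} :=
  (ZFSet.sep (fun M => γ.toZFSet ∉ M) t).sUnion

theorem mem_unionOmitting {t x : ZFSet.{u}} {γ : Ordinal.{u}} :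
    x ∈ unionOmitting t γ ↔ ∃ M ∈ t, γ.toZFSet ∉ M ∧ x ∈ M := by
  simp [unionOmitting, and_assoc]

/-- A stage `α` of cofinality `κ` of a chain of length `κ⁺` is the union of a tower of length `κ`,
all of whose proper initial segments are elements of the stage, as soon as a cofinal sequence of
order type `κ` in `α` has its initial segments in a sequence `a` that the models can decode. Such a
stage is good. -/
theorem isGood_of_approaching (hΦ : WeaklyReflecting Φ) (hΨ : ClosedUnderDisjointUnions Ψ)
    (hκ : κ.IsRegular) (hκ' : ℵ₀ < κ) {g : Operations.{u}}
    (hg : ∀ K, IsChain g κ K → IsStationary {i : Set.Iio κ.ord | IsGood Φ Ψ (K i)})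
    {a : Ordinal.{u} → ZFSet.{u}}
    (h : IsChain ((Operations.unary fun x => a x.rank).union (Operations.ternary fun a t x =>
      tower g {i | i.toZFSet ∈ a} (unionOmitting t) ∅ x.rank)) (Order.succ κ) N)
    {α : Set.Iio (Order.succ κ).ord} (hκα : κ.ord < α)
    (hα : ∀ i < α.1, ∀ o,
      (o < (Order.succ κ).ord ∧ o.toZFSet ∈ N i ∨ o = Order.succ i) → o < α.1)
    {c : Ordinal.{u} → Ordinal.{u}} (hc : ∀ i j, i < j → j < κ.ord → c i < c j)
    (hcα : ∀ i < κ.ord, c i < α) (hcof : ∀ γ < α.1, ∃ i < κ.ord, γ ≤ c i)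
    (ha : ∀ j < κ.ord, ∃ β < α.1, ∀ γ, γ.toZFSet ∈ a β ↔ ∃ i < j, γ = c i) :
    IsGood Φ Ψ (N α) := by
  have hM := h.isModel α α.2
  obtain ⟨hop₁, hop₂⟩ := Operations.isClosed_union.1 hM.operations
  have hκlim := Cardinal.isSuccLimit_ord hκ.aleph0_le
  have hlim : Order.IsSuccLimit α.1 := by
    refine ⟨fun h => not_lt_of_ge (h.isBot 0) (hκ.ord_pos.trans hκα), fun β hβ => ?_⟩
    exact (hα β hβ.1 _ (Or.inr rfl)).ne' (Order.succ_eq_of_covBy hβ).symm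
  have hord : ∀ o < α.1, o.toZFSet ∈ N α := fun o ho => h.toZFSet_mem α.2 ho
  let Z : Ordinal.{u} → ZFSet.{u} := fun γ =>
    ZFSet.iUnion fun k : {k : Set.Iio (Order.succ κ).ord // γ.toZFSet ∉ N k} => N k.1
  have hZ : ∀ γ x, x ∈ Z γ ↔ ∃ k < (Order.succ κ).ord, γ.toZFSet ∉ N k ∧ x ∈ N k := by
    intro γ x
    rw [ZFSet.mem_iUnion]
    constructor
    · rintro ⟨k, hk⟩
      exact ⟨k.1, k.1.2, k.2, hk⟩
    · rintro ⟨k, hk, hγ, hx⟩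
      exact ⟨⟨⟨k, hk⟩, hγ⟩, hx⟩
  -- By monotonicity, `Z γ` can be computed from any initial segment of the chain that includes a
  -- model containing `γ`.
  have hZsub : ∀ γ i, i < (Order.succ κ).ord → γ.toZFSet ∈ N i → Z γ ⊆ N i := by
    intro γ i hi hγ x hx
    obtain ⟨k, hk, hγk, hxk⟩ := (hZ γ x).1 hx
    rcases le_total k i with hki | hik
    · exact h.mono k i hki hi hxk
    · exact absurd (h.mono i k hik hk hγ) hγk
  set A : Set Ordinal.{u} := {γ | ∃ i < κ.ord, γ = c i}
  have hK := isChain_tower (f := g) hκ hκ' hc Z (b := ∅) (by simpa using hκ.pos)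
  set K : Ordinal.{u} → ZFSet.{u} := fun j => tower g A Z ∅ (c j)
  have hKα : ∀ j < κ.ord, K j ∈ N α := by
    intro j hj
    obtain ⟨β, hβ, hβa⟩ := ha j hj
    obtain ⟨t, htα, ht⟩ := h.initial (c j) α (hcα j hj) α.2
    have haα : a β ∈ N α := by
      simpa using hop₁.unary (hord β hβ)
    have hmem := hop₂.ternary haα htα (hord _ (hcα j hj))
    convert hmem using 1
    rw [Ordinal.rank_toZFSet]
    refine tower_congr _ _ (fun γ hγ => ?_) (fun γ hγ _ => ?_)
    · change _ ↔ γ.toZFSet ∈ a β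
      rw [hβa]
      constructor
      · rintro ⟨i, hi, rfl⟩
        exact ⟨i, not_le.1 fun hji => by
          rcases hji.eq_or_lt with rfl | hji
          · exact lt_irrefl _ hγ
          · exact (hc j i hji hi).not_gt hγ, rfl⟩
      · rintro ⟨i, hi, rfl⟩
        exact ⟨i, hi.trans hj, rfl⟩
    · ext x
      rw [hZ, mem_unionOmitting]
      constructor
      · rintro ⟨k, hk, hγk, hx⟩
        refine ⟨N k, (ht _).2 ⟨k, not_lt.1 fun hlt => hγk ?_, rfl⟩, hγk, hx⟩
        exact h.toZFSet_mem hk (hγ.trans hlt)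
      · rintro ⟨_, hM', hγM, hx⟩
        obtain ⟨k, hk, rfl⟩ := (ht _).1 hM'
        exact ⟨k, hk.trans_lt ((hcα j hj).trans α.2), hγM, hx⟩
  have hKsub : ∀ j < κ.ord, K j ⊆ N α := fun j hj => hM.subset_of_mem (hKα j hj) fun z hz => by
    obtain ⟨o, ho, rfl⟩ := Ordinal.mem_toZFSet_iff.1 hz
    exact hord o ((ho.trans (ord_lt_ord.2 (hK.card_lt j hj))).trans hκα)
  refine isGood_of_isStationary hΦ hΨ hκ hκ' hK (hg _ hK) fun x =>
    ⟨fun hx => ?_, fun ⟨j, hj, hx⟩ => hKsub j hj hx⟩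
  -- A model below `α` contains all smaller ordinals of each of its ordinals below `κ⁺`, hence
  -- omits some `c j`.
  obtain ⟨i, hi, hxi, hκi⟩ : ∃ i < α.1, x ∈ N i ∧ κ.ord ≤ i := by
    obtain ⟨i, hi, hxi⟩ := h.continuous α α.2 hlim x hx
    exact ⟨max i κ.ord, max_lt hi hκα, h.mono _ _ (le_max_left _ _)
      ((max_lt hi hκα).trans α.2) hxi, le_max_right _ _⟩
  have hiκ := hi.trans α.2
  have hmis : leastMissing (N i) < α := by
    have hsucc := hlim.succ_lt hi
    refine hα _ hsucc _ (Or.inl ⟨?_, (h.isModel _ (hsucc.trans α.2)).leastMissing_mem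
      (h.mem (Order.lt_succ i) (hsucc.trans α.2))⟩)
    refine Cardinal.lt_ord.2 (lt_of_le_of_lt ?_ (h.card_lt i hiκ))
    rw [← Ordinal.card_toZFSet]
    refine ZFSet.card_mono fun z hz => ?_
    obtain ⟨o, ho, rfl⟩ := Ordinal.mem_toZFSet_iff.1 hz
    exact toZFSet_mem_of_lt_leastMissing ho
  obtain ⟨j, hj, hjc⟩ := hcof _ hmis
  have hcj : (c j).toZFSet ∉ N i := by
    intro hmem
    refine toZFSet_leastMissing_notMem (N i) ?_
    rcases hjc.eq_or_lt with e | hlt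
    · rwa [e]
    refine (h.isModel i hiκ).subset_of_mem hmem (fun z hz => ?_)
      (Ordinal.toZFSet_mem_toZFSet_iff.2 hlt)
    obtain ⟨o, ho, rfl⟩ := Ordinal.mem_toZFSet_iff.1 hz
    refine h.toZFSet_mem hiκ (ho.trans_le (le_trans (ord_le_ord.2 ?_) hκi))
    rw [Ordinal.card_toZFSet]
    exact Order.lt_succ_iff.1 (Cardinal.lt_ord.1 ((hcα j hj).trans α.2))
  have hxZ : x ∈ Z (c j) := (hZ _ _).2 ⟨i, hiκ, hcj, hxi⟩
  have hZcard : (Z (c j)).card ≤ κ := by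
    have hs := (hlim.succ_lt (hcα j hj)).trans α.2
    refine Order.lt_succ_iff.1 ((ZFSet.card_mono (hZsub (c j) _ hs ?_)).trans_lt (h.card_lt _ hs))
    exact h.toZFSet_mem hs (Order.lt_succ _)
  have hidx : indexIn (Z (c j)) x < κ.ord := (indexIn_lt hxZ).trans_le (ord_le_ord.2 hZcard)
  have hsj := hκlim.succ_lt hj
  refine ⟨max (Order.succ j) (Order.succ (indexIn (Z (c j)) x)),
    max_lt hsj (hκlim.succ_lt hidx), ?_⟩
  have hm := max_lt hsj (hκlim.succ_lt hidx)
  have hmem := (hK.isModel _ hm).enumSet_mem (x := Z (c j)) (hK.mono _ _ (le_max_left _ _) hm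
    ((mem_tower _ _ _ _).2 (Or.inr ⟨c j, hc _ _ (Order.lt_succ j) hsj, ⟨j, hj, rfl⟩,
      mem_towerStep _ _ _ _ _⟩))) (hK.toZFSet_mem hm (lt_max_of_lt_right (Order.lt_succ _)))
  rwa [enumSet_indexIn hxZ] at hmem

theorem hasGoodChains_succ_of_approachable (hΦ : WeaklyReflecting Φ)
    (hΨ : ClosedUnderDisjointUnions Ψ) (hκ : κ.IsRegular) (hκ' : ℵ₀ < κ)
    (ih : HasGoodChains Φ Ψ κ) {S : Set (BelowSucc κ)} (hScof : S ⊆ cofSet κ)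
    (hS : IsStationary S) (hSI : S ∈ approachabilityIdeal κ) :
    HasGoodChains Φ Ψ (Order.succ κ) := by
  obtain ⟨g, hg⟩ := ih
  obtain ⟨A, hAS, ⟨a, -, ha⟩, hSA⟩ := hSI
  obtain ⟨E, hE, hSE⟩ := not_isStationary_iff.1 hSA
  have hreg := Cardinal.isRegular_succ hκ.aleph0_le
  have hunc : ℵ₀ < Order.succ κ := hκ'.trans (Order.lt_succ κ)
  have hne := cof_Iio_ord_ne_aleph0 hreg hunc
  let a' : Ordinal.{u} → ZFSet.{u} := fun β => ZFSet.range
    fun γ : {γ : BelowSucc κ // ∃ h : β < (Order.succ κ).ord, γ ∈ a ⟨β, h⟩} => γ.1.1.toZFSet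
  have ha' : ∀ β : BelowSucc κ, ∀ γ : Ordinal.{u}, γ.toZFSet ∈ a' β ↔ ∃ η ∈ a β, η.1 = γ := by
    intro β γ
    rw [ZFSet.mem_range]
    constructor
    · rintro ⟨⟨η, hβ, hη⟩, e⟩
      exact ⟨η, hη, Ordinal.toZFSet_injective e⟩
    · rintro ⟨η, hη, rfl⟩
      exact ⟨⟨η, β.2, hη⟩, rfl⟩
  refine ⟨(Operations.unary fun x => a' x.rank).union (Operations.ternary fun a t x =>
    tower g {i | i.toZFSet ∈ a} (unionOmitting t) ∅ x.rank), fun N hN D hD => ?_⟩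
  have hκsucc : κ.ord < (Order.succ κ).ord := ord_lt_ord.2 (Order.lt_succ κ)
  obtain ⟨α, hαS, ⟨⟨hαD, hαE⟩, hαcl⟩, hακ⟩ := hS ((((hD.inter hne hE).inter hne
    (hN.isClub_closure hreg hunc)).inter hne (isClub_Ici ⟨Order.succ κ.ord,
      (Cardinal.isSuccLimit_ord hreg.aleph0_le).succ_lt hκsucc⟩)))
  refine ⟨α, ?_, hαD⟩
  have hαA : α ∈ A := by
    by_contra h
    exact Set.disjoint_left.1 hSE ⟨hαS, h⟩ hαE
  obtain ⟨c, hcα, hccof, hctype, hcinit⟩ := ha α hαA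
  rw [show (α : Ordinal.{u}).cof = κ from hScof hαS] at hctype
  obtain ⟨e, he, he'⟩ := exists_increasing_enumeration hctype
  have heα : ∀ i < κ.ord, e i < α := by
    intro i hi
    obtain ⟨η, hη, h⟩ := (he' (e i)).1 ⟨i, hi, rfl⟩
    rw [← h]
    exact hcα hη
  refine isGood_of_approaching hΦ hΨ hκ hκ' hg hN (Order.succ_le_iff.1 hακ) hαcl he heα
    (fun γ hγ => ?_)
    (fun j hj => ?_)
  · obtain ⟨η, hη, h⟩ := hccof ⟨γ, hγ.trans α.2⟩ hγ
    obtain ⟨i, hi, hi'⟩ := (he' η.1).2 ⟨η, hη, rfl⟩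
    exact ⟨i, hi, hi' ▸ h⟩
  · obtain ⟨β, hβ, h⟩ := hcinit ⟨e j, (heα j hj).trans α.2⟩ (heα j hj)
    refine ⟨β.1, hβ, fun γ => ?_⟩
    rw [ha', ← h]
    constructor
    · rintro ⟨η, ⟨hηj, hη⟩, rfl⟩
      obtain ⟨i, hi, hi'⟩ := (he' η.1).2 ⟨η, hη, rfl⟩
      refine ⟨i, not_le.1 fun hji => ?_, hi'⟩
      have hlt : e i < e j := hi' ▸ hηj
      rcases hji.eq_or_lt with rfl | hji
      · exact lt_irrefl _ hlt
      · exact (he j i hji hi).not_gt hlt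
    · rintro ⟨i, hi, rfl⟩
      obtain ⟨η, hη, h⟩ := (he' (e i)).1 ⟨i, hi.trans hj, rfl⟩
      refine ⟨η, ⟨?_, hη⟩, h⟩
      change η.1 < e j
      rw [h]
      exact he i j hi hj

/-! ### Chains of length `κ⁺` for classes of graphs of cardinality at most `κ⁺` -/

/-- If all graphs in `Φ` have cardinality at most `κ⁺`, then good members of a chain of length `κ⁺`
come from chains of length `κ` that belong to models containing the given chain: the union `K` of
such a short chain has as its ordinals below `κ⁺` exactly those below some `α < κ⁺`, and `K` has the
same trace as the model at `α` on each relevant graph, because elements of the graph can be replaced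
by their indices below `κ⁺`. -/
theorem hasGoodChains_succ_of_card_le (hΦ : WeaklyReflecting Φ)
    (hΨ : ClosedUnderDisjointUnions Ψ) (hκ : κ.IsRegular) (hκ' : ℵ₀ < κ)
    (hcard : ∀ H ∈ Φ, H.card ≤ Order.succ κ) (ih : HasGoodChains Φ Ψ κ) :
    HasGoodChains Φ Ψ (Order.succ κ) := by
  obtain ⟨g, hg⟩ := ih
  refine ⟨Operations.empty, fun N hN D hD => ?_⟩
  have hreg := Cardinal.isRegular_succ hκ.aleph0_le
  have hδ : ∀ γ : Ordinal.{u}, ∃ δ : Ordinal.{u}, ∀ h : γ < (Order.succ κ).ord,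
      ∃ d ∈ D, d.1 = δ ∧ γ < δ := by
    intro γ
    by_cases h : γ < (Order.succ κ).ord
    · obtain ⟨d, hd, hγd⟩ := exists_lt_mem_of_isClub hreg.aleph0_le hD ⟨γ, h⟩
      exact ⟨d.1, fun _ => ⟨d, hd, rfl, hγd⟩⟩
    · exact ⟨0, fun h' => absurd h' h⟩
  choose δ hδ using hδ
  obtain ⟨K, hK, -⟩ := exists_isChain (g.union ((Operations.unary fun x => (δ x.rank).toZFSet).union
    (Operations.unary fun x => N x.rank))) hκ hκ' (b := ∅) (by simpa using hκ.pos)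
  let U : ZFSet.{u} := ZFSet.iUnion fun j : Set.Iio κ.ord => K j
  have hU : ∀ x, x ∈ U ↔ ∃ j : Set.Iio κ.ord, x ∈ K j := fun x => ZFSet.mem_iUnion
  have : Nonempty (Set.Iio κ.ord) := ⟨⟨0, hκ.ord_pos⟩⟩
  have hM := isModel_of_directed (fun i j : Set.Iio κ.ord => ⟨max i j,
    hK.mono _ _ (le_max_left i j) (max i j).2, hK.mono _ _ (le_max_right i j) (max i j).2⟩)
    (fun j => hK.isModel j.1 j.2) hU
  obtain ⟨-, hop⟩ := Operations.isClosed_union.1 hM.operations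
  obtain ⟨hop₁, hop₂⟩ := Operations.isClosed_union.1 hop
  have hgood : IsGood Φ Ψ U := by
    have hK' : IsChain g κ K := hK.sub fun M hM => hM.mono
    refine isGood_of_isStationary hΦ hΨ hκ hκ' hK' (hg K hK') fun x => ?_
    rw [hU]
    exact ⟨fun ⟨j, hj⟩ => ⟨j.1, j.2, hj⟩, fun ⟨j, hj, hx⟩ => ⟨⟨j, hj⟩, hx⟩⟩
  have hUcard : U.card ≤ κ := by
    refine card_le_of_cover hκ.aleph0_le ?_ (fun j : Set.Iio κ.ord => (hK.card_lt j j.2).le)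
      (fun x hx => (hU x).1 hx)
    rw [Cardinal.mk_Iio_ordinal, card_ord]
  have hκU : κ.ord.toZFSet ⊆ U := by
    intro z hz
    obtain ⟨o, ho, rfl⟩ := Ordinal.mem_toZFSet_iff.1 hz
    have hs := (Cardinal.isSuccLimit_ord hκ.aleph0_le).succ_lt ho
    exact (hU _).2 ⟨⟨_, hs⟩, hK.toZFSet_mem hs (Order.lt_succ o)⟩
  have hUsub : ∀ x ∈ U, x.card ≤ κ → x ⊆ U := fun x hx hc => hM.subset_of_mem hx fun z hz =>
    hκU (Ordinal.toZFSet_subset_toZFSet_iff.2 (ord_le_ord.2 hc) hz)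
  set α := leastMissing U with hα
  have hαU : ∀ o < α, o.toZFSet ∈ U := fun o ho => toZFSet_mem_of_lt_leastMissing ho
  have hακ : α < (Order.succ κ).ord := by
    refine Cardinal.lt_ord.2 (Order.lt_succ_of_le (le_trans ?_ hUcard))
    rw [← Ordinal.card_toZFSet]
    refine ZFSet.card_mono fun z hz => ?_
    obtain ⟨o, ho, rfl⟩ := Ordinal.mem_toZFSet_iff.1 hz
    exact hαU o ho
  have hUα : ∀ o < (Order.succ κ).ord, o.toZFSet ∈ U → o < α := by
    intro o ho hoU
    by_contra! hle
    refine toZFSet_leastMissing_notMem U ?_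
    rcases hle.eq_or_lt with e | hlt
    · rwa [← hα, e]
    refine hUsub _ hoU ?_ (Ordinal.toZFSet_mem_toZFSet_iff.2 hlt)
    rw [Ordinal.card_toZFSet]
    exact Order.lt_succ_iff.1 (Cardinal.lt_ord.1 ho)
  have hα0 : 0 < α := hUα 0 hreg.ord_pos
    (hκU (Ordinal.toZFSet_mem_toZFSet_iff.2 hκ.ord_pos))
  have hnext : ∀ γ < α, ∃ d ∈ D, γ < d.1 ∧ d.1 < α := by
    intro γ hγ
    obtain ⟨d, hd, e, hγd⟩ := hδ γ (hγ.trans hακ)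
    refine ⟨d, hd, e ▸ hγd, hUα _ d.2 ?_⟩
    rw [e]
    simpa using hop₁.unary (hαU γ hγ)
  have hαD : (⟨α, hακ⟩ : Set.Iio (Order.succ κ).ord) ∈ D := by
    refine hD.isLUB_mem (t := {d | d ∈ D ∧ d.1 < α}) (fun d hd => hd.1) ?_
      ⟨fun d hd => hd.2.le, fun b hb => not_lt.1 fun hlt => ?_⟩
    · obtain ⟨d, hd, -, hdα⟩ := hnext 0 hα0
      exact ⟨d, hd, hdα⟩
    · obtain ⟨d, hd, hbd, hdα⟩ := hnext b.1 hlt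
      exact not_le.2 hbd (hb ⟨hd, hdα⟩)
  have hlim : Order.IsSuccLimit α := by
    refine ⟨fun h => not_lt_of_ge (h.isBot 0) hα0, fun β hβ => ?_⟩
    obtain ⟨d, -, hβd, hdα⟩ := hnext β hβ.1
    exact hβ.2 hβd hdα
  have hNU : N α ⊆ U := by
    intro x hx
    obtain ⟨i, hi, hxi⟩ := hN.continuous α hακ hlim x hx
    have hNi : N i ∈ U := by simpa using hop₂.unary (hαU i hi)
    exact hUsub _ hNi (Order.lt_succ_iff.1 (hN.card_lt i (hi.trans hακ))) hxi
  -- It remains to see that `U` and the model at `α` have the same trace on each graph `H`.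
  refine ⟨⟨α, hακ⟩, fun H hH hHα => ?_, hαD⟩
  convert hgood H hH (hNU hHα) using 1
  ext x
  simp only [ZFSet.mem_inter]
  refine and_congr_right fun hxH => ⟨fun hx => hNU hx, fun hx => ?_⟩
  have hi := hUα _ ((indexIn_lt hxH).trans_le (ord_le_ord.2 (hcard H hH)))
    (hM.indexIn_mem (hNU hHα) hx)
  have := (hN.isModel α hακ).enumSet_mem hHα (hN.toZFSet_mem hακ hi)
  rwa [enumSet_indexIn hxH] at this

/-! ### Conclusion -/

theorem weaklyReflecting_inter_card_le (hΦ : WeaklyReflecting Φ) (ν : Cardinal.{u}) :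
    WeaklyReflecting {G | G ∈ Φ ∧ G.card ≤ ν} := by
  obtain ⟨T, hT₁, hT₂⟩ := hΦ
  refine ⟨T, fun M hM hMc G hG hGM => ⟨hT₁ M hM hMc G hG.1 hGM, ?_⟩,
    fun κ hκ' hκ M h₁ h₂ h₃ h₄ h₅ G hG hG₀ => ?_⟩
  · exact (ZFSet.card_mono fun x hx => (ZFSet.mem_inter.1 hx).1).trans hG.2
  · obtain ⟨C, hC, hCG⟩ := hT₂ κ hκ' hκ M h₁ h₂ h₃ h₄ h₅ G hG.1 hG₀
    exact ⟨C, hC, fun α hα => ⟨hCG α hα,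
      (ZFSet.card_mono fun x hx => (ZFSet.mem_sdiff.1 hx).1).trans hG.2⟩⟩

/-- If chains of length `κ` have good members, then every graph in `Φ` of cardinality at most `κ`
is contained in the union of such a chain, which is good, and so belongs to `Ψ`. -/
theorem mem_of_hasGoodChains (hΦ : WeaklyReflecting Φ) (hΨ : ClosedUnderDisjointUnions Ψ)
    (hκ : κ.IsRegular) (hκ' : ℵ₀ < κ) (h : HasGoodChains Φ Ψ κ) {G : ZFSet.{u}} (hG : G ∈ Φ)
    (hcard : G.card ≤ κ) : G ∈ Ψ := by
  obtain ⟨g, hg⟩ := h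
  obtain ⟨N, hN, hb⟩ := exists_isChain g hκ hκ' (b := {G})
    (by rw [ZFSet.card_singleton]; exact Cardinal.one_lt_aleph0.trans hκ')
  let U : ZFSet.{u} := ZFSet.iUnion fun j : Set.Iio κ.ord => N j
  have hU : ∀ x, x ∈ U ↔ ∃ j < κ.ord, x ∈ N j := by
    intro x
    rw [ZFSet.mem_iUnion]
    exact ⟨fun ⟨j, hj⟩ => ⟨j.1, j.2, hj⟩, fun ⟨j, hj, hx⟩ => ⟨⟨j, hj⟩, hx⟩⟩
  have hGN : ∀ j < κ.ord, G ∈ N j := fun j hj => hb j hj (by simp)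
  have hgood := isGood_of_isStationary hΦ hΨ hκ hκ' hN (hg N hN) hU G hG
    ((hU G).2 ⟨0, hκ.ord_pos, hGN 0 hκ.ord_pos⟩)
  convert hgood using 1
  ext x
  rw [ZFSet.mem_inter, hU]
  refine ⟨fun hx => ⟨hx, ?_⟩, fun hx => hx.1⟩
  have hs := (Cardinal.isSuccLimit_ord hκ.aleph0_le).succ_lt
    ((indexIn_lt hx).trans_le (ord_le_ord.2 hcard))
  refine ⟨_, hs, ?_⟩
  have := (hN.isModel _ hs).enumSet_mem (hGN _ hs) (hN.toZFSet_mem hs (Order.lt_succ _))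
  rwa [enumSet_indexIn hx] at this

theorem hasGoodChains_of_approachability (hΦ : WeaklyReflecting Φ)
    (hΨ : ClosedUnderDisjointUnions Ψ) (hwell : WellReflecting Ψ)
    (hcountable : ∀ G ∈ Φ, G.card ≤ ℵ₀ → G ∈ Ψ)
    (happ : ∀ κ : Cardinal.{u}, ℵ₀ < κ → κ.IsRegular →
      ∃ S ⊆ cofSet κ, IsStationary S ∧ S ∈ approachabilityIdeal κ)
    (hκ : κ.IsRegular) (hκ' : ℵ₀ < κ) : HasGoodChains Φ Ψ κ := by
  induction κ using WellFoundedLT.induction with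
  | ind κ ih =>
    have ih' : ∀ μ ≤ κ, Order.IsSuccPrelimit μ → ∀ ν, ℵ₀ ≤ ν → ν < μ →
        HasGoodChains Φ Ψ (Order.succ ν) := fun μ hμ hlim ν hν hνμ =>
      ih _ ((hlim.succ_lt hνμ).trans_le hμ) (Cardinal.isRegular_succ hν)
        (hν.trans_lt (Order.lt_succ ν))
    by_cases hlim : Order.IsSuccPrelimit κ
    · exact hasGoodChains_of_limit hΦ hΨ hκ hκ' (ih' κ le_rfl hlim)
    obtain ⟨μ, hμκ⟩ := not_forall_not.1 hlim
    obtain rfl := Order.succ_eq_of_covBy hμκ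
    have hμ : ℵ₀ ≤ μ := Order.lt_succ_iff.1 hκ'
    rcases hμ.eq_or_lt with rfl | hμ'
    · rw [Cardinal.succ_aleph0]
      exact hasGoodChains_aleph_one hΦ hcountable
    rcases Cardinal.isRegular_or_isSingular hμ with hreg | hsing
    · obtain ⟨S, hScof, hS, hSI⟩ := happ μ hμ' hreg
      exact hasGoodChains_succ_of_approachable hΦ hΨ hreg hμ'
        (ih μ (Order.lt_succ μ) hreg hμ') hScof hS hSI
    · exact hasGoodChains_succ_of_isSingular hΦ hΨ hwell hsing
        (ih' μ (Order.le_succ μ) hsing.isSuccLimit.isSuccPrelimit)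

end Reflection

theorem theorem3p3 (Φ Ψ : Set ZFSet.{u})
    (hgraph : ∀ G ∈ Φ, Reflection.IsGraph G)
    (hsub : Ψ ⊆ Φ)
    (hcountable : ∀ G ∈ Φ, G.card ≤ ℵ₀ → G ∈ Ψ)
    (hunion : Reflection.ClosedUnderDisjointUnions Ψ)
    (hweak : Reflection.WeaklyReflecting Φ)
    (hwell : Reflection.WellReflecting Ψ) :
    (∀ G ∈ Φ, G.card ≤ Cardinal.aleph 2 → G ∈ Ψ) ∧
    ((∀ κ : Cardinal.{u}, ℵ₀ < κ → κ.IsRegular →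
        ∃ S ⊆ Reflection.cofSet κ, IsStationary S ∧ S ∈ Reflection.approachabilityIdeal κ) →
      Φ = Ψ) := by
  constructor
  · intro G hG hGcard
    have hsucc : Order.succ (ℵ₁ : Cardinal.{u}) = Cardinal.aleph 2 := by
      rw [Cardinal.succ_aleph, one_add_one_eq_two]
    rw [← hsucc] at hGcard
    have hΦ := Reflection.weaklyReflecting_inter_card_le hweak (Order.succ ℵ₁)
    refine Reflection.mem_of_hasGoodChains hΦ hunion
      (Cardinal.isRegular_succ Cardinal.aleph0_lt_aleph_one.le)
      (Cardinal.aleph0_lt_aleph_one.trans (Order.lt_succ _)) ?_ ⟨hG, hGcard⟩ hGcard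
    exact Reflection.hasGoodChains_succ_of_card_le hΦ hunion Cardinal.isRegular_aleph_one
      Cardinal.aleph0_lt_aleph_one (fun H hH => hH.2)
      (Reflection.hasGoodChains_aleph_one hΦ fun G hG => hcountable G hG.1)
  · intro happ
    refine Set.Subset.antisymm (fun G hG => ?_) hsub
    have hν : ℵ₀ ≤ max ℵ₀ G.card := le_max_left _ _
    have hreg := Cardinal.isRegular_succ hν
    have hunc := hν.trans_lt (Order.lt_succ _)
    exact Reflection.mem_of_hasGoodChains hweak hunion hreg hunc
      (Reflection.hasGoodChains_of_approachability hweak hunion hwell hcountable happ hreg hunc)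
      hG ((le_max_right _ _).trans (Order.le_succ _))
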